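/- Regularized Unconstrained Submodular Maximization (RUSM) is the following problem: given a finite ground set $\mathcal N$, a non-negative submodular function $g\colon 2^{\mathcal N}\to\mathbb R_{\ge 0}$ and a linear function $\ell\colon 2^{\mathcal N}\to\mathbb R$ (that is, $\ell(S)=\sum_{u\in S}a_u$ for real numbers $a_u$ of arbitrary signs), both accessible only through value oracles (a query to the oracle of $f$ with a set $S$ returns $f(S)$), find a set $T\subseteq\mathcal N$ maximizing $g(T)+\ell(T)$. For $a,b\ge 0$, a (randomized) algorithm is an $(a,b)$-approximation algorithm for RUSM if on every input its output $T\subseteq\mathcal N$ satisfies $$\mathbb E[g(T)+\ell(T)]\ \ge\ \max_{S\subseteq\mathcal N}\,[a\cdot g(S)+b\cdot \ell(S)].$$ For $\beta\in(0,1]$ let $\alpha(\beta)=\beta(1-\beta)/(1+\beta)$. Theorem. For every constant $\beta\in(0,1]$ and every constant $\varepsilon\in(0,\alpha(\beta))$ there is a polynomial-time $(\alpha(\beta)-\varepsilon,\ \beta-\varepsilon)$-approximation algorithm for RUSM. Here an algorithm is a randomized program built with branches and counted loops (possibly depending on $\beta$ and $\varepsilon$, but not on $\mathcal N$, $g$ or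 $\ell$) for a random access machine in which one step is an elementary operation on natural numbers (addition, truncated subtraction, comparison), a conversion of a natural number to a real number, a load or store (possibly with indirect addressing), an arithmetic operation or comparison on real numbers, the insertion, removal or membership test of one element in a stored set, a value-oracle query, or a fair coin flip; polynomial time means that, on every input and for all outcomes of the coin flips, the number of steps is at most $p(|\mathcal N|)$ for a fixed polynomial $p$. -/

import Mathlib

noncomputable section

namespace RUSM

/-! ### The problem -/

/-- Diminishing returns: the marginal contribution of `u` to `S` is at least its marginal
contribution to any larger set `T` that does not contain `u`. -/
def IsSubmodular {n : ℕ} (f : Finset (Fin n) → ℝ) : Prop :=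
  ∀ S T : Finset (Fin n), S ⊆ T → ∀ u, u ∉ T → f (insert u T) - f T ≤ f (insert u S) - f S

/-- A set function is linear if it sums fixed (real, possibly negative) element weights. -/
def IsLinear {n : ℕ} (f : Finset (Fin n) → ℝ) : Prop :=
  ∃ a : Fin n → ℝ, ∀ S, f S = ∑ u ∈ S, a u

/-- An instance of Regularized Unconstrained Submodular Maximization whose ground set has
`n` elements, numbered `0, …, n - 1`. -/
structure Inst (n : ℕ) where
  g : Finset (Fin n) → ℝ
  l : Finset (Fin n) → ℝ
  g_nonneg : ∀ S, 0 ≤ g S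
  g_submodular : IsSubmodular g
  l_linear : IsLinear l

/-! ### The machine model

Randomized programs for a unit-cost random access machine over the reals. The memory consists of
registers for natural numbers, registers for real numbers, and registers for subsets of the ground
set (bit arrays, which can only be changed one element at a time). The functions `g` and `l` of the
input are accessible only by value-oracle queries. Programs are finite pieces of syntax that do not
depend on `n` and mention only natural and rational constants; the randomness consists of
independent fair coin flips. Natural numbers are not multiplied in one step and reals are not
rounded, so that unit costs do not hide long computations. All loops are counted loops, which makes
every program halt; this only restricts the programs that are available. -/

/-- Contents of the memory, for a ground set with `n` elements. -/
structure State (n : ℕ) where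
  nat : ℕ → ℕ
  real : ℕ → ℝ
  set : ℕ → Finset (Fin n)

/-- Deterministic elementary instructions. The first argument is the target register, except in
the indirect stores, where the first argument holds the number of the target register. -/
inductive Instr : Type
  | natConst (x k : ℕ)
  | natAdd (x y z : ℕ)
  | natSub (x y z : ℕ)
  | natLoad (x p : ℕ)
  | natStore (p y : ℕ)
  | realConst (x : ℕ) (q : ℚ)
  | realOfNat (x y : ℕ)
  | realAdd (x y z : ℕ)
  | realSub (x y z : ℕ)
  | realMul (x y z : ℕ)
  | realDiv (x y z : ℕ)
  | realLoad (x p : ℕ)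
  | realStore (p y : ℕ)
  | setInsert (s i : ℕ)
  | setErase (s i : ℕ)
  | queryG (x s : ℕ)
  | queryL (x s : ℕ)

/-- Conditions that can be tested in one step. -/
inductive Test : Type
  | natLE (x y : ℕ)
  | realLE (x y : ℕ)
  | mem (i s : ℕ)

/-- Programs. `flip x` writes a fair random bit to the natural register `x`; `loop x c` executes
`c` as many times as the number that natural register `x` holds when the loop is entered. -/
inductive Program : Type
  | skip
  | instr (i : Instr)
  | flip (x : ℕ)
  | seq (c d : Program)
  | ite (t : Test) (c d : Program)
  | loop (x : ℕ) (c : Program)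

namespace State

variable {n : ℕ}

def setNat (σ : State n) (x v : ℕ) : State n := { σ with nat := Function.update σ.nat x v }

def setReal (σ : State n) (x : ℕ) (v : ℝ) : State n :=
  { σ with real := Function.update σ.real x v }

def setSet (σ : State n) (s : ℕ) (v : Finset (Fin n)) : State n :=
  { σ with set := Function.update σ.set s v }

/-- The start of a computation: natural register `0` holds the size of the ground set, all other
registers are zero or empty. -/
def init (n : ℕ) : State n where
  nat := Function.update (fun _ => 0) 0 n
  real := fun _ => 0
  set := fun _ => ∅

end State

/-- The effect of an elementary instruction. Subtraction of natural numbers is truncated at zero,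
a quotient with divisor zero is zero, and inserting or erasing a number that is not the number of
an element of the ground set has no effect. -/
def Instr.run {n : ℕ} (I : Inst n) (σ : State n) : Instr → State n
  | .natConst x k => σ.setNat x k
  | .natAdd x y z => σ.setNat x (σ.nat y + σ.nat z)
  | .natSub x y z => σ.setNat x (σ.nat y - σ.nat z)
  | .natLoad x p => σ.setNat x (σ.nat (σ.nat p))
  | .natStore p y => σ.setNat (σ.nat p) (σ.nat y)
  | .realConst x q => σ.setReal x (q : ℝ)
  | .realOfNat x y => σ.setReal x (σ.nat y : ℝ)
  | .realAdd x y z => σ.setReal x (σ.real y + σ.real z)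
  | .realSub x y z => σ.setReal x (σ.real y - σ.real z)
  | .realMul x y z => σ.setReal x (σ.real y * σ.real z)
  | .realDiv x y z => σ.setReal x (σ.real y / σ.real z)
  | .realLoad x p => σ.setReal x (σ.real (σ.nat p))
  | .realStore p y => σ.setReal (σ.nat p) (σ.real y)
  | .setInsert s i =>
      if h : σ.nat i < n then σ.setSet s (insert ⟨σ.nat i, h⟩ (σ.set s)) else σ
  | .setErase s i =>
      if h : σ.nat i < n then σ.setSet s ((σ.set s).erase ⟨σ.nat i, h⟩) else σ
  | .queryG x s => σ.setReal x (I.g (σ.set s))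
  | .queryL x s => σ.setReal x (I.l (σ.set s))

/-- The outcome of a test. -/
def Test.Holds {n : ℕ} (σ : State n) : Test → Prop
  | .natLE x y => σ.nat x ≤ σ.nat y
  | .realLE x y => σ.real x ≤ σ.real y
  | .mem i s => ∃ h : σ.nat i < n, (⟨σ.nat i, h⟩ : Fin n) ∈ σ.set s

/-- Repeat a randomized, step-counting computation `k` times; every check of the loop counter
costs one step. -/
def iterate {n : ℕ} (f : State n → PMF (State n × ℕ)) : ℕ → State n → PMF (State n × ℕ)
  | 0, σ => PMF.pure (σ, 1)
  | k + 1, σ => (f σ).bind fun r => (iterate f k r.1).map fun r' => (r'.1, r.2 + r'.2 + 1)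

namespace Program

open Classical in
/-- The joint distribution of the final memory and the number of executed steps. Every elementary
instruction (in particular every oracle query), coin flip, test and check of a loop counter is one
step. -/
def exec {n : ℕ} (I : Inst n) : Program → State n → PMF (State n × ℕ)
  | skip, σ => PMF.pure (σ, 0)
  | instr i, σ => PMF.pure (i.run I σ, 1)
  | flip x, σ => (PMF.uniformOfFintype Bool).map fun b => (σ.setNat x b.toNat, 1)
  | seq c d, σ => (exec I c σ).bind fun r => (exec I d r.1).map fun r' => (r'.1, r.2 + r'.2)
  | ite t c d, σ =>
      (if t.Holds σ then exec I c σ else exec I d σ).map fun r => (r.1, r.2 + 1)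
  | loop x c, σ => iterate (exec I c) (σ.nat x) σ

/-- The distribution of the output, which is the final content of set register `0`. -/
def output (P : Program) {n : ℕ} (I : Inst n) : PMF (Finset (Fin n)) :=
  (P.exec I (State.init n)).map fun r => r.1.set 0

/-- The expectation `𝔼[g(T) + ℓ(T)]` for the output `T`. -/
def expectedValue (P : Program) {n : ℕ} (I : Inst n) : ℝ :=
  ∑ T : Finset (Fin n), (P.output I T).toReal * (I.g T + I.l T)

/-- On every input, and whatever the coin flips are, the number of steps is at most a fixed
polynomial in the size of the ground set. -/
def IsPolynomialTime (P : Program) : Prop :=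
  ∃ p : Polynomial ℕ, ∀ (n : ℕ) (I : Inst n),
    ∀ r ∈ (P.exec I (State.init n)).support, r.2 ≤ p.eval n

/-- `(a, b)`-approximation: `𝔼[g(T) + ℓ(T)] ≥ max_S [a g(S) + b ℓ(S)]` on every input. -/
def IsApproximation (P : Program) (a b : ℝ) : Prop :=
  ∀ (n : ℕ) (I : Inst n),
    Finset.univ.sup' Finset.univ_nonempty (fun S : Finset (Fin n) => a * I.g S + b * I.l S)
      ≤ P.expectedValue I

end Program

/-- The coefficient `α(β) = β(1 - β)/(1 + β)`. -/
def alpha (β : ℝ) : ℝ := β * (1 - β) / (1 + β)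

end RUSM

end

/-!
Let `G` be the multilinear extension of `g` and `L` that of `ℓ`. Since `g` is submodular, `G` is
concave along comparable directions; together with the lemma of Feige, Mirrokni and Vondrák this
gives, for `x ∈ [0, p]ⁿ` and every set `S`,
`p (1 - p) g(S) ≤ ⟨∇G(x), p · 1_S - x⟩ + (1 + p) G(x)`.
Hence a point of the box `[0, p]ⁿ` at which no direction `p · 1_S - x` ascends for the function
`G + (1 + p) L` is a good fractional solution. By the regret bound of online gradient ascent, the
iterates of projected stochastic gradient ascent satisfy the same guarantee on average, so it
suffices to take a uniformly random number of steps and to sample from the point reached.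

Gradients are estimated by marginals of a single random set. Fair coins sample exactly once the
coordinates are rounded down to dyadic rationals and the number of steps is a power of two. Only
elements with a positive marginal `ρ g({u} | ∅) + ℓ(u)` can be worth taking; on these the gradient
estimates are bounded by a multiple of `n` times the optimum, so polynomially many steps make the
regret negligible.
-/

noncomputable section

namespace RUSM

/-! ### The multilinear extension -/

section MultilinearExt

variable {α : Type*} [Fintype α] [DecidableEq α]

/-- The multilinear extension of a set function `f`, evaluated at `x`: the expectation of `f R` for
a random set `R` that contains every element `u` independently with probability `x u`. -/
def multilinearExt (f : Finset α → ℝ) (x : α → ℝ) : ℝ :=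
  ∑ R, ((∏ u ∈ R, x u) * ∏ u ∈ Rᶜ, (1 - x u)) * f R

/-- The marginal contribution of `u` to a set, whether or not `u` belongs to it. Averaged over the
random set of `multilinearExt`, it is the partial derivative of the extension. -/
def marginal {α : Type*} [DecidableEq α] (f : Finset α → ℝ) (u : α) (R : Finset α) : ℝ :=
  f (insert u R) - f (R.erase u)

variable {f g : Finset α → ℝ} {x y : α → ℝ}

theorem multilinearExt_add (f g : Finset α → ℝ) (x : α → ℝ) :
    multilinearExt (fun R => f R + g R) x = multilinearExt f x + multilinearExt g x := by
  simp only [multilinearExt, mul_add, Finset.sum_add_distrib]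

theorem multilinearExt_sub (f g : Finset α → ℝ) (x : α → ℝ) :
    multilinearExt (fun R => f R - g R) x = multilinearExt f x - multilinearExt g x := by
  simp only [multilinearExt, mul_sub, Finset.sum_sub_distrib]

theorem multilinearExt_const_mul (c : ℝ) (f : Finset α → ℝ) (x : α → ℝ) :
    multilinearExt (fun R => c * f R) x = c * multilinearExt f x := by
  simp only [multilinearExt, mul_left_comm _ c, Finset.mul_sum]

theorem multilinearExt_sum {ι : Type*} (s : Finset ι) (f : ι → Finset α → ℝ) (x : α → ℝ) :
    multilinearExt (fun R => ∑ i ∈ s, f i R) x = ∑ i ∈ s, multilinearExt (f i) x := by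
  simp only [multilinearExt, Finset.mul_sum]
  exact Finset.sum_comm

theorem multilinearExt_const (c : ℝ) (x : α → ℝ) : multilinearExt (fun _ => c) x = c := by
  have total := Finset.prod_add x (fun u => 1 - x u) Finset.univ
  simp only [add_sub_cancel, Finset.prod_const_one, Finset.powerset_univ,
    ← Finset.compl_eq_univ_sdiff] at total
  rw [multilinearExt, ← Finset.sum_mul, ← total, one_mul]

theorem multilinearExt_zero (f : Finset α → ℝ) : multilinearExt f 0 = f ∅ := by
  rw [multilinearExt, Finset.sum_eq_single ∅]
  · simp
  · intro R _ hR
    obtain ⟨u, hu⟩ := Finset.nonempty_iff_ne_empty.2 hR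
    simp [Finset.prod_eq_zero hu]
  · simp

theorem multilinearExt_mono_of_support (hx : x ∈ Set.Icc 0 1) {N : Finset α}
    (hN : ∀ u, u ∉ N → x u = 0) (hfg : ∀ R, R ⊆ N → f R ≤ g R) :
    multilinearExt f x ≤ multilinearExt g x := by
  refine Finset.sum_le_sum fun R _ => ?_
  by_cases hR : R ⊆ N
  · have weight_nonneg : 0 ≤ (∏ u ∈ R, x u) * ∏ u ∈ Rᶜ, (1 - x u) :=
      mul_nonneg (Finset.prod_nonneg fun u _ => hx.1 u)
        (Finset.prod_nonneg fun u _ => sub_nonneg.2 (hx.2 u))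
    exact mul_le_mul_of_nonneg_left (hfg R hR) weight_nonneg
  · obtain ⟨u, huR, huN⟩ := Finset.not_subset.1 hR
    simp [Finset.prod_eq_zero huR (hN u huN)]

theorem multilinearExt_mono (hx : x ∈ Set.Icc 0 1) (hfg : ∀ R, f R ≤ g R) :
    multilinearExt f x ≤ multilinearExt g x :=
  multilinearExt_mono_of_support hx (N := Finset.univ) (by simp) fun R _ => hfg R

theorem multilinearExt_eq_sum_erase (f : Finset α → ℝ) (x : α → ℝ) (u : α) :
    multilinearExt f x = ∑ R ∈ (Finset.univ.erase u).powerset,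
      ((∏ v ∈ R, x v) * ∏ v ∈ (insert u R)ᶜ, (1 - x v)) *
        (x u * f (insert u R) + (1 - x u) * f R) := by
  rw [multilinearExt, ← Finset.powerset_univ, ← Finset.insert_erase (Finset.mem_univ u),
    Finset.sum_powerset_insert (Finset.notMem_erase u _), ← Finset.sum_add_distrib]
  refine Finset.sum_congr (by simp) fun R hR => ?_
  have hu : u ∉ R := fun h => by simpa using Finset.mem_powerset.1 hR h
  rw [Finset.prod_insert hu, Finset.compl_insert,
    ← Finset.mul_prod_erase Rᶜ (fun v => 1 - x v) (Finset.mem_compl.2 hu)]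
  ring

theorem multilinearExt_update (f : Finset α → ℝ) (x : α → ℝ) (u : α) (t : ℝ) :
    multilinearExt f (Function.update x u t) =
      t * multilinearExt (fun R => f (insert u R)) x
        + (1 - t) * multilinearExt (fun R => f (R.erase u)) x := by
  simp only [multilinearExt_eq_sum_erase _ _ u, Finset.mul_sum, ← Finset.sum_add_distrib]
  refine Finset.sum_congr rfl fun R hR => ?_
  have hu : u ∉ R := fun h => by simpa using Finset.mem_powerset.1 hR h
  have compl_eq : ∏ v ∈ (insert u R)ᶜ, (1 - Function.update x u t v) =
      ∏ v ∈ (insert u R)ᶜ, (1 - x v) :=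
    Finset.prod_congr rfl fun v hv => by
      rw [Function.update_of_ne fun h => by simp [h] at hv]
  rw [Finset.prod_update_of_notMem hu, compl_eq, Function.update_self, Finset.insert_idem,
    Finset.erase_insert hu, Finset.erase_eq_of_notMem hu]
  ring

theorem multilinearExt_eq_insert_add_erase (f : Finset α → ℝ) (x : α → ℝ) (u : α) :
    multilinearExt f x =
      x u * multilinearExt (fun R => f (insert u R)) x
        + (1 - x u) * multilinearExt (fun R => f (R.erase u)) x := by
  rw [← multilinearExt_update, Function.update_eq_self]

theorem multilinearExt_update_eq_add (f : Finset α → ℝ) (x : α → ℝ) (u : α) (t : ℝ) :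
    multilinearExt f (Function.update x u t) =
      multilinearExt f x + (t - x u) * multilinearExt (marginal f u) x := by
  have split := multilinearExt_eq_insert_add_erase f x u
  unfold marginal
  rw [multilinearExt_update, multilinearExt_sub]
  linear_combination -split

theorem multilinearExt_piecewise_one (f : Finset α → ℝ) (x : α → ℝ) (S : Finset α) :
    multilinearExt f (S.piecewise 1 x) = multilinearExt (fun R => f (R ∪ S)) x := by
  induction S using Finset.induction_on generalizing f with
  | empty => simp
  | insert u S _ ih =>
    rw [Finset.piecewise_insert, multilinearExt_update, ih]
    simp

theorem multilinearExt_piecewise_zero (f : Finset α → ℝ) (x : α → ℝ) (S : Finset α) :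
    multilinearExt f (S.piecewise 0 x) = multilinearExt (fun R => f (R \ S)) x := by
  induction S using Finset.induction_on generalizing f with
  | empty => simp
  | insert u S _ ih =>
    rw [Finset.piecewise_insert, multilinearExt_update]
    simp [ih, Finset.sdiff_insert]

theorem multilinearExt_linear (a x : α → ℝ) :
    multilinearExt (fun R => ∑ u ∈ R, a u) x = ∑ u, x u * a u := by
  have indicator (R : Finset α) : ∑ u ∈ R, a u = ∑ u, if u ∈ R then a u else 0 := by simp
  simp only [indicator, multilinearExt_sum]
  refine Finset.sum_congr rfl fun u _ => ?_
  rw [multilinearExt_eq_insert_add_erase _ x u]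
  simp [multilinearExt_const]

end MultilinearExt

section Resample

variable {α : Type*} [DecidableEq α]

/-- The expectation of `f` after the membership of `u` in the argument has been drawn anew, where
`u` becomes a member with probability `x u`. -/
def resample (x : α → ℝ) (u : α) (f : Finset α → ℝ) (R : Finset α) : ℝ :=
  x u * f (insert u R) + (1 - x u) * f (R.erase u)

theorem foldr_resample_congr (x : α → ℝ) (f : Finset α → ℝ) {L : List α} {R R' : Finset α}
    (h : ∀ u, u ∉ L → (u ∈ R ↔ u ∈ R')) :
    L.foldr (resample x) f R = L.foldr (resample x) f R' := by
  induction L generalizing R R' with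
  | nil => rw [Finset.ext fun u => h u List.not_mem_nil]
  | cons u L ih =>
    simp only [List.foldr_cons, resample]
    rw [ih (R := insert u R) (R' := insert u R') (by grind),
      ih (R := R.erase u) (R' := R'.erase u) (by grind)]

theorem foldr_resample_eq_multilinearExt [Fintype α] (x : α → ℝ) (f : Finset α → ℝ) {L : List α}
    (hL : ∀ u, u ∈ L) (R : Finset α) : L.foldr (resample x) f R = multilinearExt f x := by
  have stationary (L : List α) :
      multilinearExt (L.foldr (resample x) f) x = multilinearExt f x := by
    induction L with
    | nil => rfl
    | cons u L ih =>
      rw [← ih, multilinearExt_eq_insert_add_erase (L.foldr (resample x) f) x u]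
      rw [← multilinearExt_const_mul, ← multilinearExt_const_mul, ← multilinearExt_add]
      rfl
  have start_irrelevant (R' : Finset α) :
      L.foldr (resample x) f R' = L.foldr (resample x) f R :=
    foldr_resample_congr x f fun u hu => absurd (hL u) hu
  rw [← stationary L, funext start_irrelevant, multilinearExt_const]

end Resample

/-! ### Concavity in comparable directions -/

section Concavity

variable {α : Type*} [Fintype α] [DecidableEq α] {f : Finset α → ℝ} {x y : α → ℝ}

theorem multilinearExt_sub_le_sum {c : α → ℝ}
    (h : ∀ (T : Finset α) (u : α),
      (y u - x u) * multilinearExt (marginal f u) (T.piecewise y x) ≤ c u) :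
    multilinearExt f y - multilinearExt f x ≤ ∑ u, c u := by
  suffices ∀ T : Finset α,
      multilinearExt f (T.piecewise y x) - multilinearExt f x ≤ ∑ u ∈ T, c u by
    simpa using this Finset.univ
  intro T
  induction T using Finset.induction_on with
  | empty => simp
  | insert u T hu ih =>
    rw [Finset.piecewise_insert, multilinearExt_update_eq_add,
      Finset.piecewise_eq_of_notMem _ _ _ hu, Finset.sum_insert hu]
    linarith [h T u]

theorem multilinearExt_antitoneOn (hf : Antitone f) :
    AntitoneOn (multilinearExt f) (Set.Icc 0 1) := by
  intro x hx y hy hxy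
  have marginal_nonpos (u : α) (R : Finset α) : marginal f u R ≤ 0 :=
    sub_nonpos.2 (hf ((R.erase_subset u).trans (R.subset_insert u)))
  have step (T : Finset α) (u : α) :
      (y u - x u) * multilinearExt (marginal f u) (T.piecewise y x) ≤ 0 :=
    mul_nonpos_of_nonneg_of_nonpos (sub_nonneg.2 (hxy u)) <|
      (multilinearExt_mono (T.piecewise_mem_Icc_of_mem_of_mem hy hx) (marginal_nonpos u)).trans_eq
        (multilinearExt_const 0 _)
  simpa using multilinearExt_sub_le_sum step

theorem multilinearExt_sub_le_of_antitone_marginal (hf : ∀ u, Antitone (marginal f u))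
    (hx : x ∈ Set.Icc 0 1) (hy : y ∈ Set.Icc 0 1) (hxy : x ≤ y ∨ y ≤ x) :
    multilinearExt f y - multilinearExt f x ≤
      ∑ u, (y u - x u) * multilinearExt (marginal f u) x := by
  refine multilinearExt_sub_le_sum fun T u => ?_
  have hT := T.piecewise_mem_Icc_of_mem_of_mem hy hx
  obtain hxy | hyx := hxy
  · exact mul_le_mul_of_nonneg_left (multilinearExt_antitoneOn (hf u) hx hT
      (T.le_piecewise_of_le_of_le hxy le_rfl)) (sub_nonneg.2 (hxy u))
  · exact mul_le_mul_of_nonpos_left (multilinearExt_antitoneOn (hf u) hT hx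
      (T.piecewise_le_of_le_of_le hyx le_rfl)) (sub_nonpos.2 (hyx u))

theorem le_multilinearExt_of_antitone_marginal (hf : ∀ u, Antitone (marginal f u))
    (hx : x ∈ Set.Icc 0 1) (hy : y ∈ Set.Icc 0 1) (hxy : x ≤ y) {p : ℝ} (hp0 : 0 ≤ p)
    (hp1 : p ≤ 1) :
    (1 - p) * multilinearExt f x + p * multilinearExt f y ≤
      multilinearExt f ((1 - p) • x + p • y) := by
  set z := (1 - p) • x + p • y
  have hz_apply (u : α) : z u = (1 - p) * x u + p * y u := rfl
  have hxz : x ≤ z := fun u => by nlinarith [hz_apply u, hxy u]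
  have hzy : z ≤ y := fun u => by nlinarith [hz_apply u, hxy u]
  have hz_mem : z ∈ Set.Icc 0 1 := ⟨hx.1.trans hxz, hzy.trans hy.2⟩
  have below := multilinearExt_sub_le_of_antitone_marginal hf hz_mem hx (.inr hxz)
  have above := multilinearExt_sub_le_of_antitone_marginal hf hz_mem hy (.inl hzy)
  have cancel : (1 - p) * ∑ u, (x u - z u) * multilinearExt (marginal f u) z
      + p * ∑ u, (y u - z u) * multilinearExt (marginal f u) z = 0 := by
    rw [Finset.mul_sum, Finset.mul_sum, ← Finset.sum_add_distrib]
    refine Finset.sum_eq_zero fun u _ => ?_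
    rw [hz_apply]
    ring
  linarith [mul_le_mul_of_nonneg_left below (sub_nonneg.2 hp1),
    mul_le_mul_of_nonneg_left above hp0]

theorem le_multilinearExt_piecewise_const (hf : ∀ u, Antitone (marginal f u)) {p : ℝ} (hp0 : 0 ≤ p)
    (hp1 : p ≤ 1) (hx : x ∈ Set.Icc 0 1) (S : Finset α) :
    (1 - p) * multilinearExt (fun R => f (R \ S)) x + p * multilinearExt (fun R => f (R ∪ S)) x ≤
      multilinearExt f (S.piecewise (fun _ => p) x) := by
  have midpoint : (1 - p) • (S.piecewise 0 x : α → ℝ) + p • (S.piecewise 1 x : α → ℝ) =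
      S.piecewise (fun _ => p) x := by
    ext u
    by_cases hu : u ∈ S
    · simp [hu]
    · simp only [Pi.add_apply, Pi.smul_apply, smul_eq_mul, hu, not_false_eq_true,
        Finset.piecewise_eq_of_notMem]
      ring
  rw [← multilinearExt_piecewise_zero, ← multilinearExt_piecewise_one, ← midpoint]
  exact le_multilinearExt_of_antitone_marginal hf
    (S.piecewise_mem_Icc_of_mem_of_mem ⟨le_rfl, zero_le_one⟩ hx)
    (S.piecewise_mem_Icc_of_mem_of_mem ⟨zero_le_one, le_rfl⟩ hx)
    (S.piecewise_le_piecewise zero_le_one le_rfl) hp0 hp1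

end Concavity

/-- The point `p · 1_S` of the cube. -/
def corner {α : Type*} [DecidableEq α] (p : ℝ) (S : Finset α) : α → ℝ := S.piecewise (fun _ => p) 0

namespace IsSubmodular

variable {n : ℕ} {g : Finset (Fin n) → ℝ}

theorem antitone_marginal (hg : IsSubmodular g) (u : Fin n) : Antitone (marginal g u) := by
  intro A B hAB
  have diminishing := hg (A.erase u) (B.erase u) (Finset.erase_subset_erase u hAB) u
    (Finset.notMem_erase u B)
  have insert_erase (R : Finset (Fin n)) : insert u (R.erase u) = insert u R := by
    grind
  rwa [insert_erase, insert_erase] at diminishing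

theorem union_add_empty_le (hg : IsSubmodular g) {A B : Finset (Fin n)} (hAB : Disjoint A B) :
    g (A ∪ B) + g ∅ ≤ g A + g B := by
  induction B using Finset.induction_on with
  | empty => simp
  | insert u B hu ih =>
    rw [Finset.disjoint_insert_right] at hAB
    have diminishing := hg B (A ∪ B) Finset.subset_union_right u (by simp [hAB.1, hu])
    rw [Finset.union_insert]
    linarith [ih hAB.2]

theorem le_empty_add_sum (hg : IsSubmodular g) (R : Finset (Fin n)) :
    g R ≤ g ∅ + ∑ u ∈ R, (g {u} - g ∅) := by
  induction R using Finset.induction_on with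
  | empty => simp
  | insert u R hu ih =>
    have subadditive := hg.union_add_empty_le (Finset.disjoint_singleton_left.2 hu)
    rw [Finset.sum_insert hu, Finset.insert_eq]
    linarith

/-- The lemma of Feige, Mirrokni and Vondrák on the union of `S` with a random set. -/
theorem one_sub_mul_le_multilinearExt_union (hg : IsSubmodular g) (hg0 : ∀ S, 0 ≤ g S) {p : ℝ}
    (hp0 : 0 < p) (hp1 : p ≤ 1) {x : Fin n → ℝ} (hx : x ∈ Set.Icc 0 (fun _ => p))
    (S : Finset (Fin n)) : (1 - p) * g S ≤ multilinearExt (fun R => g (R ∪ S)) x := by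
  have h0 : (0 : Fin n → ℝ) ∈ Set.Icc 0 1 := ⟨le_rfl, zero_le_one⟩
  have h1 : (1 : Fin n → ℝ) ∈ Set.Icc 0 1 := ⟨zero_le_one, le_rfl⟩
  have hxp : (fun u => x u / p) ∈ Set.Icc (0 : Fin n → ℝ) 1 :=
    ⟨fun u => div_nonneg (hx.1 u) hp0.le, fun u => (div_le_one hp0).2 (hx.2 u)⟩
  have chord := le_multilinearExt_of_antitone_marginal hg.antitone_marginal
    (S.piecewise_mem_Icc_of_mem_of_mem h1 h0) (S.piecewise_mem_Icc_of_mem_of_mem h1 hxp)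
    (S.piecewise_le_piecewise le_rfl hxp.1) hp0.le hp1
  have point : (1 - p) • S.piecewise 1 0 + p • S.piecewise 1 (fun u => x u / p) =
      S.piecewise 1 x := by
    ext u
    by_cases hu : u ∈ S <;> simp [hu, mul_div_cancel₀ _ hp0.ne']
  simp only [point, multilinearExt_piecewise_one, multilinearExt_zero, Finset.empty_union] at chord
  have tail_nonneg : 0 ≤ multilinearExt (fun R => g (R ∪ S)) fun u => x u / p :=
    (multilinearExt_const 0 _).ge.trans (multilinearExt_mono hxp fun R => hg0 _)
  linarith [mul_nonneg hp0.le tail_nonneg]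

theorem mul_le_sum_marginal_add (hg : IsSubmodular g) (hg0 : ∀ S, 0 ≤ g S) {p : ℝ} (hp0 : 0 < p)
    (hp1 : p ≤ 1) {x : Fin n → ℝ} (hx : x ∈ Set.Icc 0 (fun _ => p)) (S : Finset (Fin n)) :
    p * (1 - p) * g S ≤
      ∑ u, (corner p S u - x u) * multilinearExt (marginal g u) x
        + (1 + p) * multilinearExt g x := by
  have h0 : (0 : Fin n → ℝ) ∈ Set.Icc 0 1 := ⟨le_rfl, zero_le_one⟩
  have hx1 : x ∈ Set.Icc 0 1 := ⟨hx.1, hx.2.trans fun _ => hp1⟩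
  have hp : (fun _ => p) ∈ Set.Icc (0 : Fin n → ℝ) 1 := ⟨fun _ => hp0.le, fun _ => hp1⟩
  have to_inter := multilinearExt_sub_le_of_antitone_marginal hg.antitone_marginal hx1
    (Sᶜ.piecewise_mem_Icc_of_mem_of_mem h0 hx1) (.inr (Sᶜ.piecewise_le_of_le_of_le hx.1 le_rfl))
  have to_union := multilinearExt_sub_le_of_antitone_marginal hg.antitone_marginal hx1
    (S.piecewise_mem_Icc_of_mem_of_mem hp hx1) (.inl (S.le_piecewise_of_le_of_le hx.2 le_rfl))
  have chord := le_multilinearExt_piecewise_const hg.antitone_marginal hp0.le hp1 hx1 S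
  have directions : ∑ u, (corner p S u - x u) * multilinearExt (marginal g u) x =
      ∑ u, (Sᶜ.piecewise 0 x u - x u) * multilinearExt (marginal g u) x
        + ∑ u, (S.piecewise (fun _ => p) x u - x u) * multilinearExt (marginal g u) x := by
    rw [← Finset.sum_add_distrib]
    refine Finset.sum_congr rfl fun u _ => ?_
    by_cases hu : u ∈ S <;> simp [corner, hu]
  simp only [multilinearExt_piecewise_zero, sdiff_compl, Finset.inf_eq_inter] at to_inter
  have split : multilinearExt g x ≤ multilinearExt (fun R => g (R ∩ S)) x
      + multilinearExt (fun R => g (R \ S)) x := by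
    rw [← multilinearExt_add]
    refine multilinearExt_mono hx1 fun R => ?_
    have submodular := hg.union_add_empty_le (R.disjoint_sdiff_inter S)
    rw [Finset.sdiff_union_inter] at submodular
    linarith [hg0 ∅]
  have inter_nonneg : 0 ≤ multilinearExt (fun R => g (R ∩ S)) x :=
    (multilinearExt_const 0 _).ge.trans (multilinearExt_mono hx1 fun R => hg0 _)
  have union := hg.one_sub_mul_le_multilinearExt_union hg0 hp0 hp1 hx S
  rw [directions]
  linarith [mul_le_mul_of_nonneg_left split (sub_nonneg.2 hp1), mul_nonneg hp0.le inter_nonneg,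
    mul_le_mul_of_nonneg_left union hp0.le]

end IsSubmodular

/-! ### Projected gradient ascent -/

section Ascent

variable {n : ℕ} (g : Finset (Fin n) → ℝ) (a : Fin n → ℝ) (p : ℝ)

/-- The set function `g + ℓ` to be maximized, where `a` are the weights of `ℓ`. -/
def objective (R : Finset (Fin n)) : ℝ := g R + ∑ u ∈ R, a u

/-- An estimate, from a sample `R`, of the ascent direction in coordinate `u`. Its mean is the
partial derivative of the multilinear extension of `g + (1 + p) ℓ`; the weight `1 + p` makes the
linear part match the factor of the objective in `IsSubmodular.mul_le_sum_marginal_add`. -/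
def grad (u : Fin n) (R : Finset (Fin n)) : ℝ := marginal g u R + (1 + p) * a u

/-- One ascent step of step size `r` from `x`, projected to the box `[0, p]ⁿ`. -/
def ascend (r : ℝ) (x : Fin n → ℝ) (R : Finset (Fin n)) : Fin n → ℝ :=
  fun u => min p (max 0 (x u + r * grad g a p u R))

/-- Rounding down to multiples of `1 / T` on `N`, and to zero elsewhere: fair coins sample exactly
from a point whose coordinates have a power of two as denominator. -/
def roundDown (N : Finset (Fin n)) (T : ℕ) (x : Fin n → ℝ) : Fin n → ℝ :=
  fun u => if u ∈ N then (⌊x u * T⌋₊ : ℝ) / T else 0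

/-- The squared distance from the corner `p · 1_S`, in the coordinates of `N`. -/
def sqDist (N S : Finset (Fin n)) (x : Fin n → ℝ) : ℝ := ∑ u ∈ N, (corner p S u - x u) ^ 2

/-- The expectation of `F` after one ascent step from `x` along a sample from the rounded `x`. -/
def ascentStep (N : Finset (Fin n)) (T : ℕ) (r : ℝ) (F : (Fin n → ℝ) → ℝ) (x : Fin n → ℝ) : ℝ :=
  multilinearExt (fun R => F (ascend g a p r x R)) (roundDown N T x)

/-- The expected value of a sample drawn after `t` ascent steps from `x`. -/
def ascentValue (N : Finset (Fin n)) (T : ℕ) (r : ℝ) (t : ℕ) : (Fin n → ℝ) → ℝ :=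
  (ascentStep g a p N T r)^[t] fun x => multilinearExt (objective g a) (roundDown N T x)

theorem ascentValue_zero (N : Finset (Fin n)) (T : ℕ) (r : ℝ) (x : Fin n → ℝ) :
    ascentValue g a p N T r 0 x = multilinearExt (objective g a) (roundDown N T x) := rfl

theorem ascentValue_succ (N : Finset (Fin n)) (T : ℕ) (r : ℝ) (t : ℕ) (x : Fin n → ℝ) :
    ascentValue g a p N T r (t + 1) x =
      multilinearExt (fun R => ascentValue g a p N T r t (ascend g a p r x R))
        (roundDown N T x) :=
  congr_fun (Function.iterate_succ_apply' _ t _) x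

variable {g a p} {S N : Finset (Fin n)} {T : ℕ} {x : Fin n → ℝ}

theorem multilinearExt_objective (x : Fin n → ℝ) :
    multilinearExt (objective g a) x = multilinearExt g x + ∑ u, x u * a u := by
  rw [← multilinearExt_linear, ← multilinearExt_add]
  rfl

theorem multilinearExt_grad (u : Fin n) (x : Fin n → ℝ) :
    multilinearExt (grad g a p u) x = multilinearExt (marginal g u) x + (1 + p) * a u := by
  rw [← multilinearExt_const ((1 + p) * a u) x, ← multilinearExt_add]
  rfl

theorem corner_mem_Icc (hp0 : 0 ≤ p) (S : Finset (Fin n)) :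
    corner p S ∈ Set.Icc 0 (fun _ => p) :=
  S.piecewise_mem_Icc_of_mem_of_mem ⟨fun _ => hp0, le_rfl⟩ ⟨le_rfl, fun _ => hp0⟩

theorem ascend_mem_Icc (hp0 : 0 ≤ p) (r : ℝ) (x : Fin n → ℝ) (R : Finset (Fin n)) :
    ascend g a p r x R ∈ Set.Icc 0 (fun _ => p) :=
  ⟨fun _ => le_min hp0 (le_max_left _ _), fun _ => min_le_left _ _⟩

theorem roundDown_of_notMem {u : Fin n} (hu : u ∉ N) : roundDown N T x u = 0 := if_neg hu

theorem roundDown_mem_Icc (hT : 0 < T) (hx : 0 ≤ x) : roundDown N T x ∈ Set.Icc 0 x := by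
  refine ⟨fun u => ?_, fun u => ?_⟩ <;> unfold roundDown <;> split_ifs
  · exact div_nonneg (Nat.cast_nonneg _) (Nat.cast_nonneg _)
  · exact le_rfl
  · exact (div_le_iff₀ (Nat.cast_pos.2 hT)).2
      (Nat.floor_le (mul_nonneg (hx u) (Nat.cast_nonneg T)))
  · exact hx u

theorem sub_roundDown_le (hT : 0 < T) {u : Fin n} (hu : u ∈ N) :
    x u - roundDown N T x u ≤ 1 / T := by
  rw [roundDown, if_pos hu, sub_le_iff_le_add, ← add_div, le_div_iff₀ (Nat.cast_pos.2 hT), add_comm]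
  exact (Nat.lt_floor_add_one _).le

theorem le_sum_grad_add_objective (hg : IsSubmodular g) (hg0 : ∀ S, 0 ≤ g S) (hp0 : 0 < p)
    (hp1 : p ≤ 1) (hx : x ∈ Set.Icc 0 (fun _ => p)) (S : Finset (Fin n)) :
    p * (1 - p) * g S + (1 + p) * (p * ∑ u ∈ S, a u) ≤
      ∑ u, (corner p S u - x u) * multilinearExt (grad g a p u) x
        + (1 + p) * multilinearExt (objective g a) x := by
  have corner_weight : p * ∑ u ∈ S, a u = ∑ u, corner p S u * a u := by
    simp [corner, Finset.piecewise, Finset.mul_sum, ite_mul]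
  have linear_part : ∑ u, (corner p S u - x u) * multilinearExt (grad g a p u) x =
      ∑ u, (corner p S u - x u) * multilinearExt (marginal g u) x
        + (1 + p) * (p * ∑ u ∈ S, a u) - (1 + p) * ∑ u, x u * a u := by
    simp only [corner_weight, multilinearExt_grad, Finset.mul_sum, ← Finset.sum_add_distrib,
      ← Finset.sum_sub_distrib]
    exact Finset.sum_congr rfl fun u _ => by ring
  rw [multilinearExt_objective, linear_part]
  linarith [hg.mul_le_sum_marginal_add hg0 hp0 hp1 hx S]

theorem sq_sub_clamp_le {y : ℝ} (hy : y ∈ Set.Icc 0 p) (z : ℝ) :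
    (y - min p (max 0 z)) ^ 2 ≤ (y - z) ^ 2 := by
  obtain ⟨hy0, hyp⟩ := hy
  rcases le_total z 0 with hz | hz
  · rw [max_eq_left hz, min_eq_right (hy0.trans hyp)]
    nlinarith
  · rw [max_eq_right hz]
    rcases le_total p z with hpz | hzp
    · rw [min_eq_left hpz]
      nlinarith
    · rw [min_eq_right hzp]

theorem mul_le_sq_sub_clamp {D M y x G : ℝ} (hD : 0 ≤ D) (hM : 0 < M) (hy : y ∈ Set.Icc 0 p)
    (hG : |G| ≤ 2 * D) :
    (y - x) * G ≤ D * M / 2 * ((y - x) ^ 2 - (y - min p (max 0 (x + 1 / (D * M) * G))) ^ 2)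
      + 2 * D / M := by
  rcases hD.eq_or_lt with rfl | hD
  · have : G = 0 := by simpa using hG
    simp [this]
  have closer := sq_sub_clamp_le hy (x + 1 / (D * M) * G)
  have unclamped : D * M / 2 * ((y - x) ^ 2 - (y - (x + 1 / (D * M) * G)) ^ 2) =
      (y - x) * G - G ^ 2 / (2 * (D * M)) := by
    field_simp
    ring
  have second_order : G ^ 2 / (2 * (D * M)) ≤ 2 * D / M := by
    have sq_le : G ^ 2 ≤ (2 * D) ^ 2 := sq_le_sq' (neg_le_of_abs_le hG) (le_of_abs_le hG)
    rw [div_le_div_iff₀ (by positivity) hM]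
    nlinarith [mul_le_mul_of_nonneg_left sq_le hM.le]
  linarith [mul_le_mul_of_nonneg_left closer (by positivity : 0 ≤ D * M / 2)]

section Step

variable {D M : ℝ} (hD : 0 ≤ D) (hM : 0 < M) (hT : 0 < T)
  (hG : ∀ u ∈ N, ∀ R, R ⊆ N → |grad g a p u R| ≤ 2 * D) (hp0 : 0 < p) (hp1 : p ≤ 1)
  (hx : x ∈ Set.Icc 0 (fun _ => p))

include hT hx in
theorem roundDown_mem_box : roundDown N T x ∈ Set.Icc 0 (fun _ => p) :=
  ⟨(roundDown_mem_Icc hT hx.1).1, (roundDown_mem_Icc hT hx.1).2.trans hx.2⟩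

include hT hx hp1 in
theorem roundDown_mem_unit : roundDown N T x ∈ Set.Icc 0 1 :=
  ⟨(roundDown_mem_Icc hT hx.1).1, (roundDown_mem_box hT hx).2.trans fun _ => hp1⟩

include hD hM hT hG hp1 hx in
theorem mul_multilinearExt_grad_le {u : Fin n} (hu : u ∈ N) {y : ℝ} (hy : y ∈ Set.Icc 0 p) :
    (y - roundDown N T x u) * multilinearExt (grad g a p u) (roundDown N T x) ≤
      D * M / 2 * ((y - x u) ^ 2 - multilinearExt
          (fun R => (y - ascend g a p (1 / (D * M)) x R u) ^ 2) (roundDown N T x))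
        + (2 * D / M + 2 * D / T) := by
  set z := roundDown N T x
  have hz : z ∈ Set.Icc 0 1 := roundDown_mem_unit hT hp1 hx
  have progress : (y - x u) * multilinearExt (grad g a p u) z ≤
      multilinearExt (fun R => D * M / 2 * ((y - x u) ^ 2
        - (y - ascend g a p (1 / (D * M)) x R u) ^ 2) + 2 * D / M) z := by
    rw [← multilinearExt_const_mul]
    exact multilinearExt_mono_of_support hz (fun _ => roundDown_of_notMem) fun R hR =>
      mul_le_sq_sub_clamp hD hM hy (hG u hu R hR)
  rw [multilinearExt_add, multilinearExt_const, multilinearExt_const_mul, multilinearExt_sub,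
    multilinearExt_const] at progress
  have grad_le : multilinearExt (grad g a p u) z ≤ 2 * D :=
    (multilinearExt_mono_of_support hz (fun _ => roundDown_of_notMem) fun R hR =>
      le_of_abs_le (hG u hu R hR)).trans_eq (multilinearExt_const _ z)
  have rounding : (x u - z u) * multilinearExt (grad g a p u) z ≤ 2 * D / T :=
    calc (x u - z u) * multilinearExt (grad g a p u) z ≤ (x u - z u) * (2 * D) :=
          mul_le_mul_of_nonneg_left grad_le (sub_nonneg.2 ((roundDown_mem_Icc hT hx.1).2 u))
      _ ≤ 1 / T * (2 * D) :=
          mul_le_mul_of_nonneg_right (sub_roundDown_le hT hu) (by positivity)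
      _ = 2 * D / T := by ring
  linarith

variable (hg : IsSubmodular g) (hg0 : ∀ S, 0 ≤ g S) (hS : S ⊆ N)

include hg hg0 hS hD hM hT hG hp0 hp1 hx in
theorem le_sqDist_sub_add_objective :
    p * (1 - p) * g S + (1 + p) * (p * ∑ u ∈ S, a u) - N.card * (2 * D / M + 2 * D / T) ≤
      D * M / 2 * (sqDist p N S x
          - ascentStep g a p N T (1 / (D * M)) (sqDist p N S) x)
        + (1 + p) * multilinearExt (objective g a) (roundDown N T x) := by
  have inequality := le_sum_grad_add_objective (a := a) hg hg0 hp0 hp1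
    (roundDown_mem_box (N := N) hT hx) S
  have support : ∑ u, (corner p S u - roundDown N T x u) *
        multilinearExt (grad g a p u) (roundDown N T x) =
      ∑ u ∈ N, (corner p S u - roundDown N T x u) *
        multilinearExt (grad g a p u) (roundDown N T x) := by
    refine (Finset.sum_subset (Finset.subset_univ N) fun u _ hu => ?_).symm
    rw [roundDown_of_notMem hu, corner, Finset.piecewise_eq_of_notMem _ _ _ fun h => hu (hS h)]
    simp
  have coordinates := Finset.sum_le_sum fun u hu =>
    mul_multilinearExt_grad_le hD hM hT hG hp1 hx hu
      ⟨(corner_mem_Icc hp0.le S).1 u, (corner_mem_Icc hp0.le S).2 u⟩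
  rw [Finset.sum_add_distrib, ← Finset.mul_sum, Finset.sum_sub_distrib, ← multilinearExt_sum,
    Finset.sum_const, nsmul_eq_mul] at coordinates
  unfold ascentStep sqDist
  linarith

include hg hg0 hS hD hM hT hG hp0 hp1 hx in
theorem le_sum_ascentValue (k : ℕ) :
    k * (p * (1 - p) * g S + (1 + p) * (p * ∑ u ∈ S, a u)
        - N.card * (2 * D / M + 2 * D / T)) - D * M / 2 * sqDist p N S x ≤
      (1 + p) * ∑ t ∈ Finset.range k, ascentValue g a p N T (1 / (D * M)) t x := by
  induction k generalizing x with
  | zero =>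
    have : 0 ≤ D * M / 2 * sqDist p N S x :=
      mul_nonneg (by positivity) (Finset.sum_nonneg fun u _ => sq_nonneg _)
    simpa using this
  | succ k ih =>
    have first := le_sqDist_sub_add_objective hD hM hT hG hp0 hp1 hx hg hg0 hS
    have remaining := multilinearExt_mono (roundDown_mem_unit (N := N) hT hp1 hx) fun R =>
      ih (ascend_mem_Icc (g := g) (a := a) hp0.le (1 / (D * M)) x R)
    rw [multilinearExt_sub, multilinearExt_const, multilinearExt_const_mul,
      multilinearExt_const_mul, multilinearExt_sum] at remaining
    rw [Finset.sum_range_succ', ascentValue_zero]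
    simp only [ascentValue_succ]
    unfold ascentStep at first
    push_cast
    linarith

end Step

end Ascent

section Guarantee

variable {n : ℕ} (g : Finset (Fin n) → ℝ) (a : Fin n → ℝ) (ρ : ℝ)

open Classical in
/-- The elements whose addition to the empty set increases `ρ g + ℓ`. -/
def useful : Finset (Fin n) := Finset.univ.filter fun u => 0 < ρ * (g {u} - g ∅) + a u

/-- The unit of the step size: large enough to bound the gradient estimates (`abs_grad_le`), and
small enough to be `O(n)` times the optimum (`scale_le`). -/
def scale : ℝ := g ∅ + ∑ u ∈ useful g a ρ, (3 * g {u} + a u)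

variable {g a ρ}

theorem mem_useful {u : Fin n} : u ∈ useful g a ρ ↔ 0 < ρ * (g {u} - g ∅) + a u := by
  simp [useful]

theorem le_inter_useful (hg : IsSubmodular g) (hρ : 0 ≤ ρ) (S : Finset (Fin n)) :
    ρ * g S + ∑ u ∈ S, a u ≤
      ρ * g (S ∩ useful g a ρ) + ∑ u ∈ S ∩ useful g a ρ, a u := by
  set N := useful g a ρ
  have split := hg.union_add_empty_le (A := S ∩ N) (B := S \ N)
    (Finset.disjoint_sdiff_inter S N).symm
  rw [Finset.union_comm, Finset.sdiff_union_inter] at split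
  have bound : g S - g (S ∩ N) ≤ ∑ u ∈ S \ N, (g {u} - g ∅) := by
    linarith [hg.le_empty_add_sum (S \ N)]
  have useless : ∑ u ∈ S \ N, (ρ * (g {u} - g ∅) + a u) ≤ 0 :=
    Finset.sum_nonpos fun u hu => not_lt.1 fun h => (Finset.mem_sdiff.1 hu).2 (mem_useful.2 h)
  rw [Finset.sum_add_distrib, ← Finset.mul_sum] at useless
  linarith [mul_le_mul_of_nonneg_left bound hρ, Finset.sum_inter_add_sum_sdiff S N a]

theorem le_empty_add_sum_singleton (hg : IsSubmodular g) (hg0 : ∀ S, 0 ≤ g S)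
    {N X : Finset (Fin n)} (hX : X ⊆ N) : g X ≤ g ∅ + ∑ u ∈ N, g {u} :=
  calc g X ≤ g ∅ + ∑ u ∈ X, (g {u} - g ∅) := hg.le_empty_add_sum X
    _ ≤ g ∅ + ∑ u ∈ X, g {u} := by
        gcongr
        exact sub_le_self _ (hg0 ∅)
    _ ≤ g ∅ + ∑ u ∈ N, g {u} := by
        gcongr
        exact fun _ _ _ => hg0 _

theorem abs_marginal_le (hg : IsSubmodular g) (hg0 : ∀ S, 0 ≤ g S) {N R : Finset (Fin n)}
    {u : Fin n} (hu : u ∈ N) (hR : R ⊆ N) : |marginal g u R| ≤ g ∅ + ∑ v ∈ N, g {v} := by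
  have with_u := le_empty_add_sum_singleton hg hg0 (Finset.insert_subset hu hR)
  have without_u := le_empty_add_sum_singleton hg hg0 ((Finset.erase_subset u R).trans hR)
  rw [marginal, abs_le]
  constructor <;> linarith [hg0 (insert u R), hg0 (R.erase u)]

section Scale

variable (hg0 : ∀ S, 0 ≤ g S) (hρ : 0 ≤ ρ) (hρ1 : ρ ≤ 1)

include hg0 hρ hρ1 in
theorem add_abs_weight_le {u : Fin n} (hu : u ∈ useful g a ρ) :
    g {u} + |a u| ≤ 3 * g {u} + a u := by
  have gain := mem_useful.1 hu
  have scaled : ρ * g {u} ≤ g {u} := mul_le_of_le_one_left (hg0 {u}) hρ1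
  have offset : 0 ≤ ρ * g ∅ := mul_nonneg hρ (hg0 ∅)
  rcases abs_cases (a u) with h | h <;> linarith [hg0 {u}]

include hg0 hρ hρ1 in
theorem add_sum_add_abs_weight_le_scale {u : Fin n} (hu : u ∈ useful g a ρ) :
    g ∅ + ∑ v ∈ useful g a ρ, g {v} + |a u| ≤ scale g a ρ := by
  have weights := Finset.sum_le_sum fun v hv => add_abs_weight_le hg0 hρ hρ1 (a := a) hv
  rw [Finset.sum_add_distrib] at weights
  have single := Finset.single_le_sum (f := fun v => |a v|) (fun v _ => abs_nonneg _) hu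
  unfold scale
  linarith

include hg0 hρ hρ1 in
theorem abs_grad_le (hg : IsSubmodular g) {p : ℝ} (hp0 : 0 ≤ p) (hp1 : p ≤ 1) {u : Fin n}
    (hu : u ∈ useful g a ρ) {R : Finset (Fin n)} (hR : R ⊆ useful g a ρ) :
    |grad g a p u R| ≤ 2 * scale g a ρ := by
  have slope := abs_marginal_le hg hg0 hu hR
  have weight : |(1 + p) * a u| ≤ 2 * |a u| := by
    rw [abs_mul, abs_of_nonneg (by linarith : 0 ≤ 1 + p)]
    exact mul_le_mul_of_nonneg_right (by linarith) (abs_nonneg _)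
  calc |grad g a p u R| ≤ |marginal g u R| + |(1 + p) * a u| := abs_add_le _ _
    _ ≤ 2 * scale g a ρ := by
        linarith [add_sum_add_abs_weight_le_scale hg0 hρ hρ1 hu, abs_nonneg (marginal g u R)]

include hg0 hρ hρ1 in
theorem scale_nonneg : 0 ≤ scale g a ρ :=
  add_nonneg (hg0 _) <| Finset.sum_nonneg fun u hu =>
    (add_nonneg (hg0 {u}) (abs_nonneg (a u))).trans (add_abs_weight_le hg0 hρ hρ1 hu)

include hg0 hρ in
theorem scale_le {τ H : ℝ} (hτ : ρ < τ)
    (hH : ∀ S, S ⊆ useful g a ρ → τ * g S + ∑ u ∈ S, a u ≤ H) :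
    scale g a ρ ≤ (n + 1) * ((3 / (τ - ρ) + 1) * H) := by
  have gap : 0 < τ - ρ := sub_pos.2 hτ
  have at_empty : τ * g ∅ ≤ H := by simpa using hH ∅ (Finset.empty_subset _)
  have H_nonneg : 0 ≤ H := (mul_nonneg (hρ.trans hτ.le) (hg0 _)).trans at_empty
  have empty_le : g ∅ ≤ H / (τ - ρ) := by
    rw [le_div_iff₀ gap]
    linarith [mul_nonneg hρ (hg0 ∅)]
  have regroup : 3 / (τ - ρ) * H = 3 * (H / (τ - ρ)) := by ring
  have singleton_le : ∀ u ∈ useful g a ρ, 3 * g {u} + a u ≤ (3 / (τ - ρ) + 1) * H := by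
    intro u hu
    have at_singleton := hH {u} (Finset.singleton_subset_iff.2 hu)
    rw [Finset.sum_singleton] at at_singleton
    have : g {u} ≤ H / (τ - ρ) := by
      rw [le_div_iff₀ gap]
      linarith [mem_useful.1 hu, mul_nonneg hρ (hg0 ∅)]
    linarith [mul_nonneg (hρ.trans hτ.le) (hg0 {u})]
  calc scale g a ρ ≤ g ∅ + (useful g a ρ).card • ((3 / (τ - ρ) + 1) * H) :=
        add_le_add_right (Finset.sum_le_card_nsmul _ _ _ singleton_le) _
    _ ≤ (3 / (τ - ρ) + 1) * H + n * ((3 / (τ - ρ) + 1) * H) := by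
        rw [nsmul_eq_mul]
        gcongr
        · have : 0 ≤ H / (τ - ρ) := by positivity
          linarith
        · exact card_finset_fin_le _
    _ = (n + 1) * ((3 / (τ - ρ) + 1) * H) := by ring

end Scale

section Average

variable {p : ℝ} (hp0 : 0 < p) (hp1 : p ≤ 1) {m T : ℕ}

theorem sqDist_zero_le (hp0 : 0 ≤ p) (hp1 : p ≤ 1) (N S : Finset (Fin n)) :
    sqDist p N S 0 ≤ n := by
  have coordinate (u : Fin n) (_ : u ∈ N) : (corner p S u - (0 : Fin n → ℝ) u) ^ 2 ≤ 1 := by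
    have := corner_mem_Icc hp0 S
    rw [Pi.zero_apply, sub_zero]
    exact pow_le_one₀ (this.1 u) ((this.2 u).trans hp1)
  calc sqDist p N S 0 ≤ N.card • (1 : ℝ) := Finset.sum_le_card_nsmul _ _ _ coordinate
    _ ≤ n := by
        rw [nsmul_one]
        exact_mod_cast card_finset_fin_le N

include hp0 hp1 in
theorem sub_le_average_ascentValue (hg : IsSubmodular g) (hg0 : ∀ S, 0 ≤ g S)
    {N S : Finset (Fin n)} (hS : S ⊆ N) {D : ℝ} (hD : 0 ≤ D)
    (hG : ∀ u ∈ N, ∀ R, R ⊆ N → |grad g a p u R| ≤ 2 * D) (hm : 0 < m) (hT : m * m ≤ T) :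
    p * ((1 - p) / (1 + p) * g S + ∑ u ∈ S, a u) - 5 * (n * (D / m)) ≤
      (∑ t ∈ Finset.range T, ascentValue g a p N T (1 / (D * m)) t 0) / T := by
  have m_pos : (0 : ℝ) < m := Nat.cast_pos.2 hm
  have T_pos : 0 < T := (Nat.mul_pos hm hm).trans_le hT
  have sq_le : (m : ℝ) * m ≤ T := mod_cast hT
  have m_le : (m : ℝ) ≤ T := mod_cast (Nat.le_mul_self m).trans hT
  have regret := le_sum_ascentValue hD m_pos T_pos hG hp0 hp1
    (x := 0) ⟨le_rfl, fun _ => hp0.le⟩ hg hg0 hS T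
  have start : D * m / 2 * sqDist p N S 0 ≤ T * (n * (D / m)) :=
    calc D * m / 2 * sqDist p N S 0 ≤ D * m * n :=
          mul_le_mul (half_le_self (by positivity)) (sqDist_zero_le hp0.le hp1 N S)
            (Finset.sum_nonneg fun _ _ => sq_nonneg _) (by positivity)
      _ = m * m * (n * (D / m)) := by field_simp
      _ ≤ T * (n * (D / m)) := mul_le_mul_of_nonneg_right sq_le (by positivity)
  have per_step : (N.card : ℝ) * (2 * D / m + 2 * D / T) ≤ 4 * (n * (D / m)) :=
    calc (N.card : ℝ) * (2 * D / m + 2 * D / T) ≤ n * (2 * D / m + 2 * D / m) := by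
          gcongr
          exact card_finset_fin_le N
      _ = 4 * (n * (D / m)) := by ring
  have rate : p * (1 - p) * g S + (1 + p) * (p * ∑ u ∈ S, a u) =
      (1 + p) * (p * ((1 - p) / (1 + p) * g S + ∑ u ∈ S, a u)) := by field_simp
  rw [rate] at regret
  rw [le_div_iff₀ (Nat.cast_pos.2 T_pos)]
  refine le_of_mul_le_mul_left ?_ (by linarith : 0 < 1 + p)
  have error_nonneg : 0 ≤ p * (T * (n * (D / m))) := by positivity
  linarith [mul_le_mul_of_nonneg_left per_step (Nat.cast_nonneg (α := ℝ) T)]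

theorem error_le {D H C δ : ℝ} (hD : 0 ≤ D) (hδ : 0 < δ) (hH : 0 ≤ H)
    (hDH : D ≤ (n + 1) * (C * H)) {c : ℕ} (hc0 : 0 < c) (hc : 5 * C / δ ≤ c) :
    5 * (n * (D / (c * (n + 1) * (n + 1) : ℕ))) ≤ δ * H := by
  have : (0 : ℝ) < c := Nat.cast_pos.2 hc0
  push_cast
  rw [← mul_div_assoc, ← mul_div_assoc, div_le_iff₀ (by positivity)]
  calc 5 * (n * D) ≤ 5 * ((n + 1) * ((n + 1) * (C * H))) := by
        gcongr
        linarith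
    _ = 5 * C * ((n + 1) * (n + 1) * H) := by ring
    _ ≤ c * δ * ((n + 1) * (n + 1) * H) :=
        mul_le_mul_of_nonneg_right ((div_le_iff₀ hδ).1 hc) (by positivity)
    _ = δ * H * (c * (n + 1) * (n + 1)) := by ring

include hp0 hp1 in
theorem mul_le_average_ascentValue (hg : IsSubmodular g) (hg0 : ∀ S, 0 ≤ g S) (hρ : 0 ≤ ρ)
    (hρp : ρ < (1 - p) / (1 + p)) {b : ℝ} (hb0 : 0 ≤ b) (hbp : b < p) {c : ℕ} (hc0 : 0 < c)
    (hc : 5 * (3 / ((1 - p) / (1 + p) - ρ) + 1) / (p - b) ≤ c)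
    (hT : c * (n + 1) * (n + 1) * (c * (n + 1) * (n + 1)) ≤ T) (S : Finset (Fin n)) :
    b * (ρ * g S + ∑ u ∈ S, a u) ≤
      (∑ t ∈ Finset.range T, ascentValue g a p (useful g a ρ) T
        (1 / (scale g a ρ * (c * (n + 1) * (n + 1) : ℕ))) t 0) / T := by
  have hρ1 : ρ ≤ 1 := hρp.le.trans ((div_le_one (by linarith)).2 (by linarith))
  set N := useful g a ρ
  set τ := (1 - p) / (1 + p)
  obtain ⟨S', hS', hmax⟩ := Finset.exists_max_image N.powerset
    (fun S => τ * g S + ∑ u ∈ S, a u) ⟨∅, Finset.empty_mem_powerset N⟩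
  simp only [Finset.mem_powerset] at hS' hmax
  set H := τ * g S' + ∑ u ∈ S', a u
  have H_nonneg : 0 ≤ H :=
    (mul_nonneg (hρ.trans hρp.le) (hg0 ∅)).trans (by simpa using hmax ∅ (Finset.empty_subset N))
  have D_nonneg : 0 ≤ scale g a ρ := scale_nonneg hg0 hρ hρ1
  have average := sub_le_average_ascentValue hp0 hp1 hg hg0 hS' D_nonneg
    (fun u hu R hR => abs_grad_le hg0 hρ hρ1 hg hp0.le hp1 hu hR) (by positivity) hT
  have error := error_le D_nonneg (sub_pos.2 hbp) H_nonneg (scale_le hg0 hρ hρp hmax) hc0 hc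
  have value_le : ρ * g S + ∑ u ∈ S, a u ≤ H :=
    calc ρ * g S + ∑ u ∈ S, a u ≤ ρ * g (S ∩ N) + ∑ u ∈ S ∩ N, a u := le_inter_useful hg hρ S
      _ ≤ τ * g (S ∩ N) + ∑ u ∈ S ∩ N, a u := by
          gcongr
          exact hg0 _
      _ ≤ H := hmax _ Finset.inter_subset_right
  linarith [mul_le_mul_of_nonneg_left value_le hb0]

end Average

end Guarantee

/-! ### Expectations and specifications of programs -/

section Expectation

variable {n : ℕ}

open Classical in
/-- The expectation of a function of the final memory, as a function of the initial memory (the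
weakest preexpectation). -/
def wp (I : Inst n) : Program → (State n → ℝ) →ₗ[ℝ] (State n → ℝ)
  | .skip => LinearMap.id
  | .instr i => LinearMap.funLeft ℝ ℝ (i.run I)
  | .flip x => (2⁻¹ : ℝ) •
      (LinearMap.funLeft ℝ ℝ (fun σ : State n => σ.setNat x 0) +
        LinearMap.funLeft ℝ ℝ fun σ : State n => σ.setNat x 1)
  | .seq c d => wp I c ∘ₗ wp I d
  | .ite t c d =>
      LinearMap.pi fun σ => LinearMap.proj σ ∘ₗ if t.Holds σ then wp I c else wp I d
  | .loop x c => LinearMap.pi fun σ => LinearMap.proj σ ∘ₗ wp I c ^ σ.nat x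

theorem wp_flip_apply (I : Inst n) (x : ℕ) (F : State n → ℝ) (σ : State n) :
    wp I (.flip x) F σ = (F (σ.setNat x 0) + F (σ.setNat x 1)) / 2 := by
  rw [div_eq_inv_mul]
  rfl

open Classical in
theorem wp_ite_apply (I : Inst n) (t : Test) (c d : Program) (F : State n → ℝ) (σ : State n) :
    wp I (.ite t c d) F σ = if t.Holds σ then wp I c F σ else wp I d F σ := by
  by_cases h : t.Holds σ <;> simp [wp, h]

theorem wp_loop_apply (I : Inst n) (x : ℕ) (c : Program) (F : State n → ℝ) (σ : State n) :
    wp I (.loop x c) F σ = (wp I c ^ σ.nat x) F σ := rfl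

theorem wp_nonneg (I : Inst n) (c : Program) {F : State n → ℝ} (hF : 0 ≤ F) : 0 ≤ wp I c F := by
  induction c generalizing F with
  | skip => exact hF
  | instr i => exact fun σ => hF (i.run I σ)
  | flip x =>
    intro σ
    rw [wp_flip_apply]
    exact div_nonneg (add_nonneg (hF _) (hF _)) zero_le_two
  | seq _ _ hc hd => exact hc (hd hF)
  | ite t c d hc hd =>
    intro σ
    rw [wp_ite_apply]
    split_ifs
    · exact hc hF σ
    · exact hd hF σ
  | loop x c hc =>
    intro σ
    rw [wp_loop_apply, Module.End.pow_apply]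
    have iterate_nonneg : 0 ≤ (wp I c)^[σ.nat x] F :=
      Function.Iterate.rec (0 ≤ ·) hF (fun _ => hc) (σ.nat x)
    exact iterate_nonneg σ

open scoped ENNReal

/-- The expectation of a nonnegative function. -/
def lmean {α : Type*} (μ : PMF α) (φ : α → ℝ≥0∞) : ℝ≥0∞ := ∑' r, μ r * φ r

theorem lmean_pure {α : Type*} (a : α) (φ : α → ℝ≥0∞) : lmean (PMF.pure a) φ = φ a := by
  rw [lmean, tsum_eq_single a fun b hb => by simp [PMF.pure_apply, hb]]
  simp

theorem lmean_bind {α β : Type*} (μ : PMF α) (ν : α → PMF β) (φ : β → ℝ≥0∞) :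
    lmean (μ.bind ν) φ = lmean μ fun a => lmean (ν a) φ := by
  simp only [lmean, PMF.bind_apply, ← ENNReal.tsum_mul_right, ← ENNReal.tsum_mul_left, mul_assoc]
  exact ENNReal.tsum_comm

theorem lmean_map {α β : Type*} (μ : PMF α) (h : α → β) (φ : β → ℝ≥0∞) :
    lmean (μ.map h) φ = lmean μ fun a => φ (h a) := by
  simp only [← PMF.bind_pure_comp, lmean_bind, Function.comp_apply, lmean_pure]

theorem lmean_flip (φ : Bool → ℝ≥0∞) :
    lmean (PMF.uniformOfFintype Bool) φ = (φ false + φ true) / 2 := by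
  rw [lmean, tsum_bool, ENNReal.div_eq_inv_mul, mul_add]
  simp [PMF.uniformOfFintype_apply]

theorem lmean_exec (I : Inst n) (c : Program) {F : State n → ℝ} (hF : 0 ≤ F) (σ : State n) :
    lmean (c.exec I σ) (fun r => ENNReal.ofReal (F r.1)) = ENNReal.ofReal (wp I c F σ) := by
  induction c generalizing F σ with
  | skip => exact lmean_pure _ _
  | instr i => exact lmean_pure _ _
  | flip x =>
    rw [Program.exec, lmean_map, lmean_flip, wp_flip_apply, ENNReal.ofReal_div_of_pos two_pos,
      ENNReal.ofReal_add (hF _) (hF _), ENNReal.ofReal_ofNat]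
    rfl
  | seq c d hc hd =>
    simp only [Program.exec, lmean_bind, lmean_map, hd hF]
    exact hc (wp_nonneg I d hF) σ
  | ite t c d hc hd =>
    rw [Program.exec, lmean_map, wp_ite_apply]
    split_ifs
    · exact hc hF σ
    · exact hd hF σ
  | loop x c hc =>
    rw [Program.exec, wp_loop_apply, Module.End.pow_apply]
    generalize σ.nat x = k
    induction k generalizing σ with
    | zero => exact lmean_pure _ _
    | succ k ih =>
      have iterate_nonneg : 0 ≤ (wp I c)^[k] F :=
        Function.Iterate.rec (0 ≤ ·) hF (fun _ => wp_nonneg I c) k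
      simp only [iterate, lmean_bind, lmean_map, ih, Function.iterate_succ_apply']
      exact hc iterate_nonneg σ

open Classical in
theorem toReal_output_apply (P : Program) (I : Inst n) (T : Finset (Fin n)) :
    (P.output I T).toReal = wp I P (fun σ => if σ.set 0 = T then 1 else 0) (State.init n) := by
  have indicator_nonneg : (0 : State n → ℝ) ≤ fun σ => if σ.set 0 = T then 1 else 0 :=
    fun σ => by positivity
  rw [← ENNReal.toReal_ofReal (wp_nonneg I P indicator_nonneg _),
    ← lmean_exec I P indicator_nonneg, Program.output, PMF.map_apply, lmean]
  simp only [eq_comm (a := T), apply_ite ENNReal.ofReal, ENNReal.ofReal_one, ENNReal.ofReal_zero,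
    mul_ite, mul_one, mul_zero]

theorem expectedValue_eq_wp (P : Program) (I : Inst n) :
    P.expectedValue I = wp I P (fun σ => I.g (σ.set 0) + I.l (σ.set 0)) (State.init n) := by
  classical
  have sum_indicators : (fun σ : State n => I.g (σ.set 0) + I.l (σ.set 0)) =
      ∑ T : Finset (Fin n), (I.g T + I.l T) • fun σ => if σ.set 0 = T then 1 else 0 := by
    ext σ
    simp
  simp only [sum_indicators, map_sum, map_smul, Finset.sum_apply, Pi.smul_apply, smul_eq_mul,
    Program.expectedValue, toReal_output_apply, mul_comm]

end Expectation

/-- `Spec I c σ t E post`: a run of `c` from `σ` takes at most `t` steps and ends in a state that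
satisfies `post a` for some abstract result `a`; and if a function of the final state is a function
`f` of the result, then its expectation is `E f`. -/
structure Spec {n : ℕ} (I : Inst n) {α : Type} (c : Program) (σ : State n) (t : ℕ)
    (E : (α → ℝ) → ℝ) (post : α → State n → Prop) : Prop where
  time : ∀ r ∈ (c.exec I σ).support, r.2 ≤ t ∧ ∃ a, post a r.1
  mean : ∀ (F : State n → ℝ) (f : α → ℝ), (∀ a σ', post a σ' → F σ' = f a) → wp I c F σ = E f

/-- The specification of a program that ends in a state that satisfies `post`, where the outcomes
of coin flips are irrelevant. -/
abbrev DetSpec {n : ℕ} (I : Inst n) (c : Program) (σ : State n) (t : ℕ) (post : State n → Prop) :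
    Prop :=
  Spec I c σ t (fun f : Unit → ℝ => f ()) fun _ => post

section Rules

variable {n : ℕ} {I : Inst n} {α β ι : Type} {c d : Program} {σ : State n} {t t' x : ℕ}
  {E : (α → ℝ) → ℝ} {post : α → State n → Prop} {Q Q' : State n → Prop}

namespace Spec

theorem conseq {E' : (β → ℝ) → ℝ} {post' : β → State n → Prop} (h : Spec I c σ t E post)
    (e : α → β) (ht : t ≤ t') (hE : ∀ f, E (fun a => f (e a)) = E' f)
    (hpost : ∀ a σ', post a σ' → post' (e a) σ') : Spec I c σ t' E' post' where
  time r hr := by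
    obtain ⟨time_le, a, ha⟩ := h.time r hr
    exact ⟨time_le.trans ht, e a, hpost a _ ha⟩
  mean F f hf := (h.mean F _ fun a σ' ha => hf _ σ' (hpost a σ' ha)).trans (hE f)

theorem mono {E' : (α → ℝ) → ℝ} (h : Spec I c σ t E post) (ht : t ≤ t') (hE : ∀ f, E f = E' f) :
    Spec I c σ t' E' post :=
  h.conseq id ht hE fun _ _ => id

theorem flip {a b : α} (h0 : post a (σ.setNat x 0)) (h1 : post b (σ.setNat x 1)) :
    Spec I (.flip x) σ 1 (fun f => (f a + f b) / 2) post where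
  time r hr := by
    rw [Program.exec, PMF.support_map] at hr
    obtain ⟨_ | _, -, rfl⟩ := hr
    · exact ⟨le_rfl, a, h0⟩
    · exact ⟨le_rfl, b, h1⟩
  mean F f hf := by rw [wp_flip_apply, hf _ _ h0, hf _ _ h1]

theorem seq {E' : α → (β → ℝ) → ℝ} {post' : β → State n → Prop} (h : Spec I c σ t E post)
    (h' : ∀ a σ', post a σ' → Spec I d σ' t' (E' a) post') :
    Spec I (.seq c d) σ (t + t') (fun f => E fun a => E' a f) post' where
  time r hr := by
    simp only [Program.exec, PMF.mem_support_bind_iff, PMF.support_map, Set.mem_image] at hr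
    obtain ⟨r₁, hr₁, r₂, hr₂, rfl⟩ := hr
    obtain ⟨time_c, a, ha⟩ := h.time r₁ hr₁
    obtain ⟨time_d, b, hb⟩ := (h' a _ ha).time r₂ hr₂
    exact ⟨Nat.add_le_add time_c time_d, b, hb⟩
  mean F f hf := h.mean _ _ fun a σ' ha => (h' a σ' ha).mean F f hf

theorem seq_det {post' : β → State n → Prop} {e : α → β} (h : Spec I c σ t E post)
    (h' : ∀ a σ', post a σ' → DetSpec I d σ' t' (post' (e a))) :
    Spec I (.seq c d) σ (t + t') (fun f => E fun a => f (e a)) post' :=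
  h.seq fun a σ' ha => (h' a σ' ha).conseq (fun _ => e a) le_rfl (fun _ => rfl) fun _ _ => id

theorem loop {L : List ι} {B : ι → (α → ℝ) → α → ℝ} {J : ℕ → α → State n → Prop}
    (hc : ∀ k (hk : k < L.length) a σ, J k a σ →
      Spec I c σ t (fun f => B L[k] f a) (J (k + 1)))
    {a : α} (h0 : J 0 a σ) (hx : σ.nat x = L.length) :
    Spec I (.loop x c) σ (L.length * (t + 1) + 1) (fun f => L.foldr B f a) (J L.length) := by
  suffices key : (∀ r ∈ (iterate (c.exec I) L.length σ).support,
        r.2 ≤ L.length * (t + 1) + 1 ∧ ∃ a, J L.length a r.1) ∧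
      ∀ F f, (∀ a σ', J L.length a σ' → F σ' = f a) →
        (wp I c)^[L.length] F σ = L.foldr B f a by
    refine ⟨by rw [Program.exec, hx]; exact key.1, fun F f hf => ?_⟩
    rw [wp_loop_apply, Module.End.pow_apply, hx]
    exact key.2 F f hf
  clear hx
  induction L generalizing J a σ with
  | nil =>
    refine ⟨fun r hr => ?_, fun F f hf => hf _ _ h0⟩
    obtain rfl := (PMF.mem_support_pure_iff _ _).1 hr
    exact ⟨Nat.le_add_left 1 _, a, h0⟩
  | cons i L ih =>
    have first := hc 0 L.length.succ_pos a σ h0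
    have rest {a' : α} {σ' : State n} (ha' : J 1 a' σ') :=
      ih (J := fun k => J (k + 1)) (fun k hk => hc (k + 1) (Nat.succ_lt_succ hk)) ha'
    refine ⟨fun r hr => ?_, fun F f hf => ?_⟩
    · simp only [List.length_cons, iterate, PMF.mem_support_bind_iff, PMF.support_map,
        Set.mem_image] at hr
      obtain ⟨r₁, hr₁, r₂, hr₂, rfl⟩ := hr
      obtain ⟨time_first, a', ha'⟩ := first.time r₁ hr₁
      obtain ⟨time_rest, result⟩ := (rest ha').1 r₂ hr₂
      refine ⟨?_, result⟩
      simp only [List.length_cons, add_mul, one_mul]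
      omega
    · rw [List.length_cons, Function.iterate_succ_apply']
      exact first.mean _ _ fun a' σ' ha' => (rest ha').2 F f hf

theorem loop_iterate {B : (α → ℝ) → α → ℝ} {N : ℕ} {J : ℕ → α → State n → Prop}
    (hc : ∀ k a σ, k < N → J k a σ → Spec I c σ t (fun f => B f a) (J (k + 1)))
    {a : α} (h0 : J 0 a σ) (hx : σ.nat x = N) :
    Spec I (.loop x c) σ (N * (t + 1) + 1) (fun f => B^[N] f a) (J N) := by
  obtain ⟨L, rfl⟩ : ∃ L : List Unit, L.length = N := ⟨.replicate N (), List.length_replicate⟩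
  refine (loop (B := fun _ => B) (fun k hk a σ => hc k a σ hk) h0 hx).mono le_rfl fun f => ?_
  rw [List.foldr_const]

end Spec

namespace DetSpec

theorem conseq (h : DetSpec I c σ t Q) (ht : t ≤ t') (hQ : ∀ σ', Q σ' → Q' σ') :
    DetSpec I c σ t' Q' :=
  Spec.conseq h id ht (fun _ => rfl) fun _ => hQ

theorem skip (h : Q σ) (t : ℕ) : DetSpec I .skip σ t Q where
  time r hr := by
    obtain rfl := (PMF.mem_support_pure_iff _ _).1 hr
    exact ⟨Nat.zero_le t, (), h⟩
  mean F f hf := hf _ _ h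

theorem instr {i : Instr} (h : Q (i.run I σ)) : DetSpec I (.instr i) σ 1 Q where
  time r hr := by
    obtain rfl := (PMF.mem_support_pure_iff _ _).1 hr
    exact ⟨le_rfl, (), h⟩
  mean F f hf := hf _ _ h

theorem seq (h : DetSpec I c σ t Q) (h' : ∀ σ', Q σ' → Spec I d σ' t' E post) :
    Spec I (.seq c d) σ (t + t') E post :=
  Spec.seq (E := fun f : Unit → ℝ => f ()) (post := fun _ => Q) (E' := fun _ => E) h fun _ => h'

theorem seq_eq {σ₁ : State n} (h : DetSpec I c σ t (· = σ₁)) (h' : Spec I d σ₁ t' E post) :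
    Spec I (.seq c d) σ (t + t') E post :=
  h.seq fun _ hσ => hσ ▸ h'

theorem ite {s : Test} (h : s.Holds σ → DetSpec I c σ t Q)
    (h' : ¬ s.Holds σ → DetSpec I d σ t Q) : DetSpec I (.ite s c d) σ (t + 1) Q := by
  obtain ⟨b, hb, exec_eq, wp_eq⟩ : ∃ b, DetSpec I b σ t Q ∧
      (Program.ite s c d).exec I σ = (b.exec I σ).map (fun r => (r.1, r.2 + 1)) ∧
      ∀ F, wp I (.ite s c d) F σ = wp I b F σ := by
    by_cases hs : s.Holds σ
    · exact ⟨c, h hs, by simp [Program.exec, hs], fun F => by rw [wp_ite_apply, if_pos hs]⟩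
    · exact ⟨d, h' hs, by simp [Program.exec, hs], fun F => by rw [wp_ite_apply, if_neg hs]⟩
  refine ⟨fun r hr => ?_, fun F f hf => (wp_eq F).trans (hb.mean F f hf)⟩
  rw [exec_eq, PMF.support_map] at hr
  obtain ⟨r', hr', rfl⟩ := hr
  exact ⟨Nat.succ_le_succ (hb.time r' hr').1, (hb.time r' hr').2⟩

theorem loop {N : ℕ} {J : ℕ → State n → Prop}
    (hc : ∀ k σ, k < N → J k σ → DetSpec I c σ t (J (k + 1))) (h0 : J 0 σ) (hx : σ.nat x = N) :
    DetSpec I (.loop x c) σ (N * (t + 1) + 1) (J N) :=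
  (Spec.loop_iterate (B := id) (J := fun k _ => J k) (fun k _ => hc k) (a := ()) h0 hx).mono
    le_rfl fun f => by rw [Function.iterate_id, id]

end DetSpec

/-- A straight-line program. -/
def block : List Instr → Program
  | [] => .skip
  | i :: s => .seq (.instr i) (block s)

/-- The effect of a straight-line program. -/
def runBlock (I : Inst n) (s : List Instr) (σ : State n) : State n :=
  s.foldl (fun σ i => i.run I σ) σ

theorem DetSpec.block {s : List Instr} (h : Q (runBlock I s σ)) :
    DetSpec I (block s) σ s.length Q := by
  induction s generalizing σ with
  | nil => exact DetSpec.skip h 0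
  | cons i s ih =>
    exact ((DetSpec.instr (Q := (· = i.run I σ)) rfl).seq_eq (ih h)).mono
      (by simp [add_comm]) fun _ => rfl

end Rules

/-! ### The algorithm -/

attribute [local simp] Instr.run State.init State.setNat State.setReal State.setSet runBlock

/-- Draw a uniformly random number with `K` bits into register `7`, where `K` is in register `6`. -/
def draw : Program :=
  .seq (block [.natConst 7 0]) (.loop 6 (.seq (.flip 8) (block [.natAdd 7 7 7, .natAdd 7 7 8])))

/-- Run `c` for all elements of the ground set, whose number is in register `1`. -/
def forEach (c : Program) : Program :=
  .seq (block [.natConst 1 0]) (.loop 0 (.seq c (block [.natAdd 1 1 2])))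

/-- Add the product of the registers `x` and `z` to register `y`. -/
def mulAdd (y x z : ℕ) : Program := .loop x (.instr (.natAdd y y z))

/-- Compute the number of bits of register `4` in register `6`, and a power of two with that
exponent in register `5`. -/
def bitSize : Program :=
  .loop 4 (.ite (.natLE 5 4) (block [.natAdd 5 5 5, .natAdd 6 6 2]) .skip)

/-- Replace register `x` by its maximum with register `y`. -/
def realMax (x y : ℕ) : Program := .ite (.realLE x y) (.instr (.realAdd x y 0)) .skip

/-- Replace register `x` by its minimum with register `y`. -/
def realMin (x y : ℕ) : Program := .ite (.realLE y x) (.instr (.realAdd x y 0)) .skip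

section Subroutines

variable {n : ℕ} {I : Inst n} {σ : State n}

theorem iterate_average_two (f : ℕ → ℝ) (m v : ℕ) :
    (fun (f : ℕ → ℝ) v => (f (2 * v) + f (2 * v + 1)) / 2)^[m] f v =
      (∑ j ∈ Finset.range (2 ^ m), f (2 ^ m * v + j)) / (2 ^ m : ℕ) := by
  induction m generalizing v with
  | zero => simp
  | succ m ih =>
    have even_half (j : ℕ) : (2 ^ m + 2 ^ m) * v + j = 2 ^ m * (2 * v) + j := by ring
    have odd_half (j : ℕ) : 2 ^ m * (2 * v) + (2 ^ m + j) = 2 ^ m * (2 * v + 1) + j := by ring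
    simp only [Function.iterate_succ_apply', ih, pow_succ 2 m, mul_two, Finset.sum_range_add,
      even_half, odd_half]
    push_cast
    field_simp
    ring

theorem spec_draw {K : ℕ} (hK : σ.nat 6 = K) :
    Spec I draw σ (4 * K + 2)
      (fun f : ℕ → ℝ => (∑ v ∈ Finset.range (2 ^ K), f v) / (2 ^ K : ℕ))
      fun v σ' => v < 2 ^ K ∧ ∃ b, σ' = (σ.setNat 7 v).setNat 8 b := by
  have bit (k v : ℕ) (σ' : State n) (h : v < 2 ^ k ∧ ∃ b, σ' = (σ.setNat 7 v).setNat 8 b) :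
      Spec I (.seq (.flip 8) (block [.natAdd 7 7 7, .natAdd 7 7 8])) σ' 3
        (fun f : ℕ → ℝ => (f (2 * v) + f (2 * v + 1)) / 2)
        fun v σ' => v < 2 ^ (k + 1) ∧ ∃ b, σ' = (σ.setNat 7 v).setNat 8 b := by
    obtain ⟨hv, b, rfl⟩ := h
    refine (Spec.flip (x := 8) (σ := (σ.setNat 7 v).setNat 8 b) (a := 0) (b := 1)
      (post := fun b σ' => b < 2 ∧ σ' = (σ.setNat 7 v).setNat 8 b) (by simp) (by simp)).seq_det
        (t' := 2) (e := (2 * v + ·)) ?_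
    rintro b _ ⟨hb, rfl⟩
    refine DetSpec.block ⟨by rw [pow_succ]; omega, b, ?_⟩
    simp [Function.update_comm (show (8 : ℕ) ≠ 7 by simp), two_mul]
  refine ((DetSpec.block (Q := (· = σ.setNat 7 0)) rfl).seq fun σ' hσ' =>
    Spec.loop_iterate (N := K) (fun k v σ' _ => bit k v σ') (a := 0) ?_ ?_).mono
    (by simp; omega) fun f => ?_
  · exact ⟨by simp, σ.nat 8, by simp [hσ']⟩
  · simp [hσ', hK]
  · simp [iterate_average_two]

theorem spec_forEach {α : Type} {c : Program} {t : ℕ} {B : Fin n → (α → ℝ) → α → ℝ}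
    {J : ℕ → α → State n → Prop} (hJ : ∀ k a σ v, J k a σ → J k a (σ.setNat 1 v))
    (hJ' : ∀ k a σ, J k a σ → σ.nat 0 = n ∧ σ.nat 2 = 1)
    (hc : ∀ (u : Fin n) a σ, J u a σ → σ.nat 1 = u →
      Spec I c σ t (fun f => B u f a) fun a σ' => J (u + 1) a σ' ∧ σ'.nat 1 = u)
    {a : α} (h0 : J 0 a σ) :
    Spec I (forEach c) σ (n * (t + 2) + 2) (fun f => (List.finRange n).foldr B f a) (J n) := by
  have body (k : ℕ) (hk : k < (List.finRange n).length) (a : α) (σ : State n)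
      (h : J k a σ ∧ σ.nat 1 = k) :
      Spec I (.seq c (block [.natAdd 1 1 2])) σ (t + 1)
        (fun f => B (List.finRange n)[k] f a) fun a σ' => J (k + 1) a σ' ∧ σ'.nat 1 = k + 1 := by
    rw [List.getElem_finRange]
    refine (hc ⟨k, by simpa using hk⟩ a σ h.1 h.2).seq_det (e := id) ?_
    rintro a σ' ⟨ha, h1⟩
    refine DetSpec.block ⟨hJ _ _ _ _ ha, ?_⟩
    simp [h1, (hJ' _ _ _ ha).2]
  refine ((DetSpec.block (Q := (· = σ.setNat 1 0)) rfl).seq fun σ' hσ' =>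
    (Spec.loop (L := List.finRange n) body (a := a) ?_ ?_).conseq id le_rfl (fun _ => rfl)
      fun a σ' h => ?_).mono
    (by rw [List.length_finRange, List.length_singleton]; ring_nf; rfl) fun _ => rfl
  · exact ⟨by simpa only [hσ'] using hJ _ _ _ 0 h0, by simp [hσ']⟩
  · simp [hσ', (hJ' _ _ _ h0).1]
  · simpa using h.1

theorem DetSpec.forEach {c : Program} {t : ℕ} {J : ℕ → State n → Prop}
    (hJ : ∀ k σ v, J k σ → J k (σ.setNat 1 v)) (hJ' : ∀ k σ, J k σ → σ.nat 0 = n ∧ σ.nat 2 = 1)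
    (hc : ∀ (u : Fin n) σ, J u σ → σ.nat 1 = u →
      DetSpec I c σ t fun σ' => J (u + 1) σ' ∧ σ'.nat 1 = u) (h0 : J 0 σ) :
    DetSpec I (forEach c) σ (n * (t + 2) + 2) (J n) :=
  (spec_forEach (B := fun _ => id) (J := fun k (_ : Unit) => J k) (fun k _ => hJ k)
    (fun k _ => hJ' k) (fun u _ => hc u) h0).mono le_rfl fun f => by
    rw [List.foldr_const, Function.iterate_id, id]

theorem spec_mulAdd {x y z k m : ℕ} (hyz : z ≠ y) (hk : σ.nat x = k)
    (hm : σ.nat y + k * σ.nat z = m) :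
    DetSpec I (mulAdd y x z) σ (k * 2 + 1) (· = σ.setNat y m) := by
  refine (DetSpec.loop (N := k) (J := fun i σ' => σ' = σ.setNat y (σ.nat y + i * σ.nat z)) ?_
    (by simp) hk).conseq le_rfl fun σ' hσ' => by rwa [hm] at hσ'
  rintro i _ - rfl
  refine DetSpec.instr ?_
  simp [hyz, add_mul, add_assoc]

theorem spec_bitSize (h2 : σ.nat 2 = 1) (h5 : σ.nat 5 = 1) (h6 : σ.nat 6 = 0) :
    DetSpec I bitSize σ (σ.nat 4 * 4 + 1)
      (· = (σ.setNat 5 (2 ^ (σ.nat 4).size)).setNat 6 (σ.nat 4).size) := by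
  set K := (σ.nat 4).size with hK
  have size_le : K ≤ σ.nat 4 := Nat.size_le.2 Nat.lt_two_pow_self
  refine (DetSpec.loop (J := fun k σ' => σ' = (σ.setNat 5 (2 ^ min k K)).setNat 6 (min k K))
    ?_ ?_ rfl).conseq le_rfl fun σ' hσ' => by rwa [min_eq_right size_le] at hσ'
  · rintro k _ - rfl
    have holds_iff : Test.Holds ((σ.setNat 5 (2 ^ min k K)).setNat 6 (min k K)) (.natLE 5 4) ↔
        k < K := by
      simp [Test.Holds, ← Nat.lt_size, ← hK]
    refine DetSpec.ite (t := 2) (fun h => DetSpec.block ?_) fun h => DetSpec.skip ?_ 2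
    · rw [holds_iff] at h
      simp [min_eq_left h.le, min_eq_left (Nat.succ_le_of_lt h), h2, pow_succ, mul_two,
        Function.update_comm (show (6 : ℕ) ≠ 5 by simp)]
    · rw [holds_iff, not_lt] at h
      simp [min_eq_right h, min_eq_right (h.trans k.le_succ)]
  · rw [Nat.zero_min, pow_zero, ← h5, ← h6]
    simp

theorem spec_realMax {x y : ℕ} (h0 : σ.real 0 = 0) :
    DetSpec I (realMax x y) σ 2 (· = σ.setReal x (max (σ.real x) (σ.real y))) := by
  refine DetSpec.ite (fun h => DetSpec.instr ?_) fun h => DetSpec.skip ?_ 1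
  · simp [h0, max_eq_right (show σ.real x ≤ σ.real y from h)]
  · simp [max_eq_left_of_lt (show σ.real y < σ.real x from not_le.1 h)]

theorem spec_realMin {x y : ℕ} (h0 : σ.real 0 = 0) :
    DetSpec I (realMin x y) σ 2 (· = σ.setReal x (min (σ.real x) (σ.real y))) := by
  refine DetSpec.ite (fun h => DetSpec.instr ?_) fun h => DetSpec.skip ?_ 1
  · simp [h0, min_eq_right (show σ.real y ≤ σ.real x from h)]
  · simp [min_eq_left_of_lt (show σ.real x < σ.real y from not_le.1 h)]

end Subroutines

/-- The memory of the algorithm between its subroutines: the point `x` is stored in the real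
registers from `16` on, `R` is the current sample, `N` the set of elements that may be sampled,
`r` the step size, and the sampling probabilities are multiples of `2 ^ (-K)`. -/
structure Ready {n : ℕ} (I : Inst n) (ρ p : ℝ) (K : ℕ) (r : ℝ) (N : Finset (Fin n))
    (x : Fin n → ℝ) (R : Finset (Fin n)) (σ : State n) : Prop where
  size : σ.nat 0 = n
  one : σ.nat 2 = 1
  bits : σ.nat 6 = K
  base : σ.nat 11 = 16
  zero : σ.real 0 = 0
  gEmpty : σ.real 1 = I.g ∅
  rate : σ.real 5 = r
  rho : σ.real 6 = ρ
  box : σ.real 7 = p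
  grid : σ.real 8 = (2 ^ K : ℕ)
  slope : σ.real 11 = 1 + p
  vec : ∀ u : Fin n, σ.real (u + 16) = x u
  sample : σ.set 0 = R
  useful : σ.set 1 = N
  temp : σ.set 2 = ∅

namespace Ready

variable {n : ℕ} {I : Inst n} {ρ p r : ℝ} {K : ℕ} {N R : Finset (Fin n)} {x : Fin n → ℝ}
  {σ : State n}

theorem setNat (h : Ready I ρ p K r N x R σ) {j : ℕ} (hj : j ∉ [0, 2, 6, 11]) (v : ℕ) :
    Ready I ρ p K r N x R (σ.setNat j v) := by
  simp only [List.mem_cons, List.not_mem_nil, or_false, not_or, ne_comm (a := j)] at hj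
  obtain ⟨h0, h2, h6, h11⟩ := hj
  exact { h with
    size := by simpa [h0] using h.size
    one := by simpa [h2] using h.one
    bits := by simpa [h6] using h.bits
    base := by simpa [h11] using h.base }

theorem setReal_ten (h : Ready I ρ p K r N x R σ) (v : ℝ) :
    Ready I ρ p K r N x R (σ.setReal 10 v) :=
  { h with vec := fun u => by simpa using h.vec u }

theorem setReal_add (h : Ready I ρ p K r N x R σ) (u : Fin n) (v : ℝ) :
    Ready I ρ p K r N (Function.update x u v) R (σ.setReal (u + 16) v) where
  __ := h
  zero := by simpa using h.zero
  gEmpty := by simpa using h.gEmpty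
  rate := by simpa using h.rate
  rho := by simpa using h.rho
  box := by simpa using h.box
  grid := by simpa using h.grid
  slope := by simpa using h.slope
  vec w := by simp [Function.update_apply, h.vec, Fin.ext_iff]

theorem setSet_zero (h : Ready I ρ p K r N x R σ) (R' : Finset (Fin n)) :
    Ready I ρ p K r N x R' (σ.setSet 0 R') :=
  { h with sample := rfl }

end Ready

/-- Resample the membership of the element in register `1` in the set `0`, with the probability
given by the rounded-down point. -/
def sampleElement : Program :=
  .seq draw <| .seq
    (block [.natAdd 9 7 2, .realOfNat 9 9, .realDiv 9 9 8, .natAdd 10 1 11, .realLoad 10 10]) <|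
    .ite (.mem 1 1)
      (.ite (.realLE 9 10) (.instr (.setInsert 0 1)) (.instr (.setErase 0 1)))
      (.instr (.setErase 0 1))

section Sampling

variable {n : ℕ} {I : Inst n} {ρ p r : ℝ} {K : ℕ} {N R : Finset (Fin n)} {x : Fin n → ℝ}
  {σ : State n}

theorem average_ite_le {T : ℕ} (hT : 0 < T) {y : ℝ} (hy : y ∈ Set.Icc 0 1) (A B : ℝ) :
    (∑ v ∈ Finset.range T, if ((v : ℝ) + 1) / T ≤ y then A else B) / T =
      (⌊y * T⌋₊ : ℝ) / T * A + (1 - (⌊y * T⌋₊ : ℝ) / T) * B := by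
  have T_pos : (0 : ℝ) < T := Nat.cast_pos.2 hT
  have below_iff (v : ℕ) : ((v : ℝ) + 1) / T ≤ y ↔ v < ⌊y * T⌋₊ := by
    rw [div_le_iff₀ T_pos, ← Nat.succ_le_iff, Nat.le_floor_iff (mul_nonneg hy.1 T_pos.le),
      Nat.cast_succ]
  have floor_le : ⌊y * T⌋₊ ≤ T :=
    Nat.floor_le_of_le (mul_le_of_le_one_left T_pos.le hy.2)
  have below_eq : {v ∈ Finset.range T | v < ⌊y * T⌋₊} = Finset.range ⌊y * T⌋₊ := by
    grind
  have above_eq : {v ∈ Finset.range T | ¬ v < ⌊y * T⌋₊} = Finset.Ico ⌊y * T⌋₊ T := by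
    grind
  simp only [below_iff, Finset.sum_ite, Finset.sum_const, below_eq, above_eq, Finset.card_range,
    Nat.card_Ico, nsmul_eq_mul, Nat.cast_sub floor_le]
  field_simp

theorem average_eq_resample {T : ℕ} (hT : 0 < T) (hx : x ∈ Set.Icc 0 1) (u : Fin n)
    (f : Finset (Fin n) → ℝ) (R : Finset (Fin n)) :
    (∑ v ∈ Finset.range T, f (if u ∈ N ∧ ((v : ℝ) + 1) / T ≤ x u then insert u R else R.erase u))
        / T = resample (roundDown N T x) u f R := by
  by_cases hu : u ∈ N
  · simpa [hu, resample, roundDown, apply_ite f] using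
      average_ite_le hT ⟨hx.1 u, hx.2 u⟩ (f (insert u R)) (f (R.erase u))
  · have : (T : ℝ) ≠ 0 := Nat.cast_ne_zero.2 hT.ne'
    simp [hu, resample, roundDown, this]

theorem spec_sampleElement (hx : x ∈ Set.Icc 0 1) {u : Fin n} (h : Ready I ρ p K r N x R σ)
    (h1 : σ.nat 1 = u) :
    Spec I sampleElement σ (4 * K + 10) (fun f => resample (roundDown N (2 ^ K) x) u f R)
      fun R' σ' => Ready I ρ p K r N x R' σ' ∧ σ'.nat 1 = u := by
  refine ((spec_draw (K := K) h.bits).seq_det (t' := 8) (e := fun v : ℕ => if u ∈ N ∧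
    ((v : ℝ) + 1) / (2 ^ K : ℕ) ≤ x u then insert u R else R.erase u) ?_).mono (by omega)
    fun f => average_eq_resample K.two_pow_pos hx u f R
  rintro v _ ⟨-, b, rfl⟩
  have ready' := ((h.setNat (j := 7) (by simp) v).setNat (j := 8) (by simp) b)
  refine (DetSpec.block (Q := fun σ' => Ready I ρ p K r N x R σ' ∧ σ'.nat 1 = u ∧
    σ'.real 9 = ((v : ℝ) + 1) / (2 ^ K : ℕ) ∧ σ'.real 10 = x u) ?_).seq (t' := 3) ?_
  · have h2 := h.one
    have h11 := h.base
    have h8 := h.grid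
    have hv := h.vec u
    refine ⟨?_, ?_, ?_, ?_⟩
    · exact { ready' with vec := fun w => by simp [h.vec] }
    · simp [h1]
    · simp [h2, h8]
    · simp [h1, h11, hv]
  · rintro σ' ⟨h, h1, h9, h10⟩
    have inserted : Ready I ρ p K r N x (insert u R) ((Instr.setInsert 0 1).run I σ') ∧
        ((Instr.setInsert 0 1).run I σ').nat 1 = u := by
      simpa [h1, h.sample] using h.setSet_zero (insert u R)
    have erased : Ready I ρ p K r N x (R.erase u) ((Instr.setErase 0 1).run I σ') ∧
        ((Instr.setErase 0 1).run I σ').nat 1 = u := by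
      simpa [h1, h.sample] using h.setSet_zero (R.erase u)
    have mem_iff : Test.Holds σ' (.mem 1 1) ↔ u ∈ N := by
      simp [Test.Holds, h1, h.useful]
    have le_iff : Test.Holds σ' (.realLE 9 10) ↔ ((v : ℝ) + 1) / (2 ^ K : ℕ) ≤ x u := by
      rw [Test.Holds, h9, h10]
    refine DetSpec.ite (fun hN => DetSpec.ite (fun hle => ?_) fun hle => ?_) fun hN => ?_
    · exact DetSpec.instr (by rwa [if_pos ⟨mem_iff.1 hN, le_iff.1 hle⟩])
    · exact DetSpec.instr (by rwa [if_neg fun h => hle (le_iff.2 h.2)])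
    · rw [if_neg fun h => hN (mem_iff.2 h.1)]
      exact (DetSpec.instr erased).conseq one_le_two fun _ => id

theorem spec_sample (hx : x ∈ Set.Icc 0 1) (h : Ready I ρ p K r N x R σ) :
    Spec I (forEach sampleElement) σ (n * (4 * K + 12) + 2)
      (fun f => multilinearExt f (roundDown N (2 ^ K) x)) (Ready I ρ p K r N x) :=
  (spec_forEach (J := fun _ => Ready I ρ p K r N x) (fun _ _ _ v h => h.setNat (by simp) v)
    (fun _ _ _ h => ⟨h.size, h.one⟩) (fun _ _ _ => spec_sampleElement hx) h).mono le_rfl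
    fun f => foldr_resample_eq_multilinearExt _ f List.mem_finRange R

end Sampling

/-- Query `g` for the set `0` with and without the element in register `1`. -/
def queryMarginal : Program :=
  .ite (.mem 1 0) (block [.queryG 2 0, .setErase 0 1, .queryG 3 0, .setInsert 0 1])
    (block [.setInsert 0 1, .queryG 2 0, .setErase 0 1, .queryG 3 0])

/-- Ascend in the coordinate of the element in register `1`. -/
def updateElement : Program :=
  .seq queryMarginal <| .seq
    (block [.setInsert 2 1, .queryL 4 2, .setErase 2 1, .realMul 4 11 4, .realSub 2 2 3,
      .realAdd 2 2 4, .realMul 2 5 2, .natAdd 10 1 11, .realLoad 10 10, .realAdd 10 10 2]) <|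
    .seq (realMax 10 0) <| .seq (realMin 10 7) (block [.realStore 10 10])

section Update

variable {n : ℕ} {I : Inst n} {a : Fin n → ℝ} {ρ p r : ℝ} {K : ℕ} {N R : Finset (Fin n)}
  {x : Fin n → ℝ} {σ : State n}

theorem spec_queryMarginal {u : Fin n} (h1 : σ.nat 1 = u) :
    DetSpec I queryMarginal σ 5 (· = (σ.setReal 2 (I.g (insert u (σ.set 0)))).setReal 3
      (I.g ((σ.set 0).erase u))) := by
  have mem_iff : Test.Holds σ (.mem 1 0) ↔ u ∈ σ.set 0 := by simp [Test.Holds, h1]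
  refine DetSpec.ite (fun h => DetSpec.block ?_) fun h => DetSpec.block ?_ <;> rw [mem_iff] at h
  · simp [h1, h, Finset.insert_erase]
  · simp [h1, h, Finset.erase_eq_of_notMem]

theorem spec_updateElement (ha : ∀ S, I.l S = ∑ v ∈ S, a v) {u : Fin n}
    (h : Ready I ρ p K r N x R σ) (h1 : σ.nat 1 = u) :
    DetSpec I updateElement σ 20 fun σ' =>
      Ready I ρ p K r N (Function.update x u (ascend I.g a p r x R u)) R σ' ∧ σ'.nat 1 = u := by
  refine ((spec_queryMarginal h1).seq_eq (t' := 15) ?_).mono le_rfl fun _ => rfl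
  refine (DetSpec.block (Q := fun σ' => Ready I ρ p K r N x R σ' ∧ σ'.nat 1 = u ∧
    σ'.nat 10 = u + 16 ∧ σ'.real 10 = x u + r * grad I.g a p u R) ?_).seq (t' := 5) ?_
  · cases h
    refine ⟨by constructor <;> simp [*], by simp [*], by simp [*, add_comm], ?_⟩
    simp [*, grad, marginal, add_comm]
  rintro σ₁ ⟨h, h1, h10, hr⟩
  refine (spec_realMax h.zero).seq_eq (t' := 3) <|
    (spec_realMin (by simpa using h.zero)).seq_eq (t' := 1) <| DetSpec.block ⟨?_, by simpa using h1⟩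
  have stored := (h.setReal_ten (ascend I.g a p r x R u)).setReal_add u (ascend I.g a p r x R u)
  simpa [h10, hr, h.zero, h.box, ascend, min_comm, max_comm] using stored

theorem spec_update (ha : ∀ S, I.l S = ∑ v ∈ S, a v) (h : Ready I ρ p K r N x R σ) :
    DetSpec I (forEach updateElement) σ (n * 22 + 2)
      (Ready I ρ p K r N (ascend I.g a p r x R) R) := by
  refine (DetSpec.forEach (J := fun k => Ready I ρ p K r N
    (fun v => if (v : ℕ) < k then ascend I.g a p r x R v else x v) R) (fun _ _ v h =>
      h.setNat (by simp) v) (fun _ _ h => ⟨h.size, h.one⟩) (fun u σ h h1 => ?_) (by simpa)).conseq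
    le_rfl fun σ' h => by simpa using h
  refine (spec_updateElement ha h h1).conseq le_rfl fun σ' h => ?_
  convert h using 3 with v
  rcases eq_or_ne v u with rfl | hvu
  · simp [ascend]
  · simp [Function.update_of_ne hvu, hvu.le_iff_lt]

end Update

/-- Put the element in register `1` into the set `1` if it is useful, and collect its contribution
to the scale in register `5`. -/
def filterElement : Program :=
  .seq
    (block [.setInsert 2 1, .queryG 2 2, .queryL 4 2, .setErase 2 1, .realSub 3 2 1, .realMul 3 6 3,
      .realAdd 3 3 4]) <|
    .ite (.realLE 3 0) .skip
      (block [.setInsert 1 1, .realAdd 5 5 2, .realAdd 5 5 2, .realAdd 5 5 2, .realAdd 5 5 4])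

section Filter

variable {n : ℕ} {I : Inst n} {a : Fin n → ℝ} {ρ p : ℝ} {K M : ℕ} {N : Finset (Fin n)}
  {σ : State n}

theorem filter_val_lt_succ (N : Finset (Fin n)) (u : Fin n) :
    N.filter (fun v => v.val < u.val + 1) =
      if u ∈ N then insert u (N.filter fun v => v.val < u.val)
      else N.filter fun v => v.val < u.val := by
  ext v
  rcases eq_or_ne v u with rfl | hvu
  · split_ifs with hv <;> simp [hv]
  · split_ifs <;> simp [hvu, hvu.le_iff_lt]

/-- The memory of the algorithm during the choice of the useful elements, when those in `N` have
been found; register `5` accumulates the scale. -/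
structure Filtering (I : Inst n) (a : Fin n → ℝ) (ρ p : ℝ) (K M : ℕ) (N : Finset (Fin n))
    (σ : State n) : Prop where
  ready : Ready I ρ p K (I.g ∅ + ∑ u ∈ N, (3 * I.g {u} + a u)) N 0 ∅ σ
  number : σ.nat 3 = M

theorem spec_filterElement (ha : ∀ S, I.l S = ∑ v ∈ S, a v) {u : Fin n} (hu : u ∉ N)
    (h : Filtering I a ρ p K M N σ) (h1 : σ.nat 1 = u) :
    DetSpec I filterElement σ 13 fun σ' =>
      Filtering I a ρ p K M (if u ∈ useful I.g a ρ then insert u N else N) σ' ∧ σ'.nat 1 = u := by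
  refine ((DetSpec.block (Q := fun σ' => Filtering I a ρ p K M N σ' ∧ σ'.nat 1 = u ∧
    σ'.real 2 = I.g {u} ∧ σ'.real 3 = ρ * (I.g {u} - I.g ∅) + a u ∧ σ'.real 4 = a u) ?_).seq
    (t' := 6) ?_).mono le_rfl fun _ => rfl
  · obtain ⟨h, h3⟩ := h
    cases h
    refine ⟨⟨by constructor <;> simp [*], by simp [*]⟩, by simp [*], by simp [*], by simp [*],
      by simp [*]⟩
  rintro σ₁ ⟨h, h1, h2, h3, h4⟩
  have le_iff : Test.Holds σ₁ (.realLE 3 0) ↔ u ∉ useful I.g a ρ := by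
    rw [mem_useful, not_lt, Test.Holds, h3, h.ready.zero]
  refine DetSpec.ite (fun hle => DetSpec.skip ?_ 5) fun hle => DetSpec.block ?_
  · rw [if_neg (le_iff.1 hle)]
    exact ⟨h, h1⟩
  · rw [if_pos (not_not.1 (mt le_iff.2 hle))]
    obtain ⟨h, hM⟩ := h
    cases h
    refine ⟨⟨?_, by simp [*]⟩, by simp [*]⟩
    constructor <;> simp [*]
    ring

theorem spec_filter (ha : ∀ S, I.l S = ∑ v ∈ S, a v) (h : Filtering I a ρ p K M ∅ σ) :
    DetSpec I (forEach filterElement) σ (n * 15 + 2)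
      (Filtering I a ρ p K M (useful I.g a ρ)) := by
  refine (DetSpec.forEach (J := fun k => Filtering I a ρ p K M
    ((useful I.g a ρ).filter fun v => v.val < k))
    (fun _ _ v h => ⟨h.ready.setNat (by simp) v, h.number⟩)
    (fun _ _ h => ⟨h.ready.size, h.ready.one⟩) (fun u σ h h1 => ?_) (by simpa)).conseq le_rfl
    fun σ' h => by simpa using h
  simpa only [filter_val_lt_succ] using spec_filterElement ha (by simp) h h1

end Filter

/-- Fill the memory with the constants of the algorithm, compute `M = c (n + 1)²` in register `3`,
and choose a power of two that exceeds `M²` as the denominator of the sampling probabilities. -/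
def setup (c : ℕ) (ρ p : ℚ) : Program :=
  .seq
    (block [.natConst 2 1, .natConst 11 16, .natConst 12 c, .natAdd 13 0 2, .natConst 5 1,
      .realConst 6 ρ, .realConst 7 p, .realConst 11 (1 + p), .queryG 1 0, .queryG 5 0]) <|
    .seq (mulAdd 14 12 13) <| .seq (mulAdd 3 14 13) <| .seq (mulAdd 4 3 3) <|
    .seq bitSize (block [.realOfNat 8 5])

/-- Take as many ascent steps as register `7` says, and sample from the point that is reached. -/
def walk : Program :=
  .seq (.loop 7 (.seq (forEach sampleElement) (forEach updateElement))) (forEach sampleElement)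

/-- Projected stochastic gradient ascent on the multilinear extension, from the origin and with a
uniformly random number of steps, followed by sampling from the point that is reached. -/
def ascent (c : ℕ) (ρ p : ℚ) : Program :=
  .seq (setup c ρ p) <| .seq (forEach filterElement) <|
    .seq (block [.realOfNat 9 3, .realMul 5 5 9, .realConst 9 1, .realDiv 5 9 5]) <|
    .seq draw walk

open Polynomial in
/-- A bound for the running time of the algorithm. -/
def timeBound (c : ℕ) : ℕ[X] :=
  let M := C c * (X + 1) * (X + 1)
  let sampling := X * (4 * (M * M) + 12) + 2
  M * M * 8 + M * 2 + C c * (X + 1) * 2 + C c * 2 + X * 15 +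
    (2 * (M * M) + 1) * (sampling + X * 22 + 3) + sampling + 24

section Algorithm

variable {n : ℕ} {I : Inst n} {a : Fin n → ℝ} {r : ℝ} {K : ℕ} {N R : Finset (Fin n)}
  {x : Fin n → ℝ} {σ : State n}

theorem spec_setup (c : ℕ) (ρ p : ℚ) (a : Fin n → ℝ) {M : ℕ} (hM : c * (n + 1) * (n + 1) = M)
    (hK : (M * M).size = K) :
    DetSpec I (setup c ρ p) (State.init n) (M * M * 4 + M * 2 + c * (n + 1) * 2 + c * 2 + 15)
      (Filtering I a ρ p K M ∅) := by
  subst hK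
  let constants : List Instr := [.natConst 2 1, .natConst 11 16, .natConst 12 c, .natAdd 13 0 2,
    .natConst 5 1, .realConst 6 ρ, .realConst 7 p, .realConst 11 (1 + p), .queryG 1 0, .queryG 5 0]
  let σ₁ := runBlock I constants (State.init n)
  let σ₂ := σ₁.setNat 14 (c * (n + 1))
  let σ₃ := σ₂.setNat 3 M
  let σ₄ := σ₃.setNat 4 (M * M)
  let σ₅ := (σ₄.setNat 5 (2 ^ (M * M).size)).setNat 6 (M * M).size
  have product : DetSpec I (mulAdd 14 12 13) σ₁ (c * 2 + 1) (· = σ₂) :=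
    spec_mulAdd (by simp) (by simp +zetaDelta) (by simp +zetaDelta)
  have number : DetSpec I (mulAdd 3 14 13) σ₂ (c * (n + 1) * 2 + 1) (· = σ₃) :=
    spec_mulAdd (by simp) (by simp +zetaDelta) (by simp +zetaDelta [hM])
  have square : DetSpec I (mulAdd 4 3 3) σ₃ (M * 2 + 1) (· = σ₄) :=
    spec_mulAdd (by simp) (by simp +zetaDelta) (by simp +zetaDelta)
  have size : DetSpec I bitSize σ₄ (M * M * 4 + 1) (· = σ₅) :=
    spec_bitSize (by simp +zetaDelta) (by simp +zetaDelta) (by simp +zetaDelta)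
  have grid : DetSpec I (block [.realOfNat 8 5]) σ₅ 1 (Filtering I a ρ p (M * M).size M ∅) := by
    refine DetSpec.block ⟨?_, by simp +zetaDelta⟩
    constructor <;> simp +zetaDelta
  refine ((DetSpec.block (s := constants) (Q := (· = σ₁)) rfl).seq_eq <| product.seq_eq <|
    number.seq_eq <| square.seq_eq <| size.seq_eq grid).mono ?_ fun _ => rfl
  rw [show constants.length = 10 from rfl]
  omega

variable {ρ p : ℝ}

theorem spec_walk (ha : ∀ S, I.l S = ∑ v ∈ S, a v) (hp0 : 0 ≤ p) (hp1 : p ≤ 1) {v : ℕ}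
    (hx : x ∈ Set.Icc 0 (fun _ => p)) (h : Ready I ρ p K r N x R σ) (h7 : σ.nat 7 = v) :
    Spec I walk σ (v * (n * (4 * K + 12) + 2 + (n * 22 + 2) + 1) + 1 + (n * (4 * K + 12) + 2))
      (fun f => (ascentStep I.g a p N (2 ^ K) r)^[v]
        (fun x => multilinearExt f (roundDown N (2 ^ K) x)) x)
      fun R σ' => σ'.set 0 = R := by
  have sample {x R σ} (hx : x ∈ Set.Icc 0 (fun _ => p)) (h : Ready I ρ p K r N x R σ) :=
    spec_sample ⟨hx.1, hx.2.trans fun _ => hp1⟩ h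
  refine (Spec.loop_iterate (J := fun _ x σ' => x ∈ Set.Icc 0 (fun _ => p) ∧
    ∃ R, Ready I ρ p K r N x R σ') ?_ ⟨hx, R, h⟩ h7).seq ?_
  · rintro - x σ - ⟨hx, R, h⟩
    exact (sample hx h).seq_det fun R' σ' h' =>
      (spec_update ha h').conseq le_rfl fun σ'' h'' => ⟨ascend_mem_Icc hp0 r x R', R', h''⟩
  · rintro x σ ⟨hx, R, h⟩
    exact (sample hx h).conseq id le_rfl (fun _ => rfl) fun R' σ' h' => h'.sample

theorem spec_draw_walk (ha : ∀ S, I.l S = ∑ v ∈ S, a v) (hp0 : 0 ≤ p) (hp1 : p ≤ 1)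
    (hx : x ∈ Set.Icc 0 (fun _ => p)) (h : Ready I ρ p K r N x R σ) :
    Spec I (.seq draw walk) σ (4 * K + 2 +
        (2 ^ K * (n * (4 * K + 12) + 2 + (n * 22 + 2) + 1) + 1 + (n * (4 * K + 12) + 2)))
      (fun f => (∑ v ∈ Finset.range (2 ^ K), (ascentStep I.g a p N (2 ^ K) r)^[v]
        (fun x => multilinearExt f (roundDown N (2 ^ K) x)) x) / (2 ^ K : ℕ))
      fun R σ' => σ'.set 0 = R := by
  refine (spec_draw h.bits).seq ?_
  rintro v _ ⟨hv, b, rfl⟩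
  have ready := (h.setNat (j := 7) (by simp) v).setNat (j := 8) (by simp) b
  exact (spec_walk ha hp0 hp1 hx ready (by simp)).mono (by gcongr) fun f => rfl

theorem spec_rate {M : ℕ} (h : Filtering I a ρ p K M (useful I.g a ρ) σ) :
    DetSpec I (block [.realOfNat 9 3, .realMul 5 5 9, .realConst 9 1, .realDiv 5 9 5]) σ 4
      (Ready I ρ p K (1 / (scale I.g a ρ * M)) (useful I.g a ρ) 0 ∅) := by
  obtain ⟨h, number⟩ := h
  cases h
  refine DetSpec.block ?_
  constructor <;> simp [*, scale]

theorem two_pow_size_le (m : ℕ) : 2 ^ m.size ≤ 2 * m + 1 := by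
  rcases hm : m.size with _ | k
  · simp
  · have two_pow_le : 2 ^ k ≤ m := Nat.lt_size.1 (hm ▸ k.lt_succ_self)
    rw [pow_succ]
    omega

open Polynomial in
theorem spec_ascent (ha : ∀ S, I.l S = ∑ v ∈ S, a v) (c : ℕ) (ρ : ℚ) {p : ℚ} (hp0 : 0 ≤ p)
    (hp1 : p ≤ 1) {M : ℕ} (hM : c * (n + 1) * (n + 1) = M) (hK : (M * M).size = K) :
    Spec I (ascent c ρ p) (State.init n) ((timeBound c).eval n)
      (fun f => (∑ v ∈ Finset.range (2 ^ K),
        (ascentStep I.g a p (useful I.g a ρ) (2 ^ K) (1 / (scale I.g a ρ * M)))^[v]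
          (fun x => multilinearExt f (roundDown (useful I.g a ρ) (2 ^ K) x)) 0) / (2 ^ K : ℕ))
      fun R σ' => σ'.set 0 = R := by
  have p_nonneg : (0 : ℝ) ≤ p := by exact_mod_cast hp0
  have p_le_one : (p : ℝ) ≤ 1 := by exact_mod_cast hp1
  have K_le : K ≤ M * M := hK ▸ Nat.size_le.2 Nat.lt_two_pow_self
  have grid_le : 2 ^ K ≤ 2 * (M * M) + 1 := hK ▸ two_pow_size_le _
  refine ((spec_setup c ρ p a hM hK).seq fun σ h => (spec_filter ha h).seq fun σ h =>
    (spec_rate h).seq fun σ h => spec_draw_walk ha p_nonneg p_le_one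
      ⟨le_rfl, fun _ => p_nonneg⟩ h).mono ?_ fun f => rfl
  have sampling_le : n * (4 * K + 12) + 2 ≤ n * (4 * (M * M) + 12) + 2 := by gcongr
  have walk_le := Nat.mul_le_mul grid_le
    (Nat.add_le_add_right sampling_le (n * 22 + 2 + 1))
  simp only [timeBound, eval_add, eval_mul, eval_X, eval_C, eval_one, eval_ofNat, hM]
  linarith

end Algorithm

section Approximation

variable {ρ p : ℚ} {c : ℕ}

theorem ascent_isPolynomialTime (c : ℕ) (ρ : ℚ) (hp0 : 0 ≤ p) (hp1 : p ≤ 1) :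
    (ascent c ρ p).IsPolynomialTime := by
  refine ⟨timeBound c, fun n I r hr => ?_⟩
  obtain ⟨a, ha⟩ := I.l_linear
  exact ((spec_ascent ha c ρ hp0 hp1 rfl rfl).time r hr).1

theorem mul_le_expectedValue_ascent (hρ : (0 : ℝ) ≤ ρ) (hp0 : 0 < p) (hp1 : p ≤ 1)
    (hρp : (ρ : ℝ) < (1 - p) / (1 + p)) {b : ℝ} (hb0 : 0 ≤ b) (hbp : b < p) (hc0 : 0 < c)
    (hc : 5 * (3 / ((1 - p) / (1 + p) - ρ) + 1) / (p - b) ≤ c) {n : ℕ} (I : Inst n)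
    (S : Finset (Fin n)) :
    b * (ρ * I.g S + I.l S) ≤ (ascent c ρ p).expectedValue I := by
  obtain ⟨a, ha⟩ := I.l_linear
  have value_eq := (spec_ascent ha c ρ hp0.le hp1 rfl rfl).mean
    (fun σ => I.g (σ.set 0) + I.l (σ.set 0)) (objective I.g a) (by rintro R σ rfl; rw [ha]; rfl)
  rw [expectedValue_eq_wp, value_eq, ha S]
  exact mul_le_average_ascentValue (mod_cast hp0) (mod_cast hp1) I.g_submodular I.g_nonneg hρ hρp
    hb0 hbp hc0 hc (Nat.lt_size_self _).le S

theorem lt_one_sub_div_one_add_comm {x y : ℝ} (hx : 0 ≤ x) (hy : 0 ≤ y) :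
    x < (1 - y) / (1 + y) ↔ y < (1 - x) / (1 + x) := by
  rw [lt_div_iff₀ (by positivity), lt_div_iff₀ (by positivity)]
  constructor <;> intro h <;> linarith

theorem exists_isApproximation {a b : ℝ} (hb : 0 < b) (hb1 : b < 1) (hab : a < alpha b) :
    ∃ P : Program, P.IsPolynomialTime ∧ P.IsApproximation a b := by
  have ratio_lt : max (a / b) 0 < (1 - b) / (1 + b) := by
    rw [alpha, mul_div_assoc] at hab
    exact max_lt ((div_lt_iff₀' hb).2 hab) (div_pos (by linarith) (by linarith))
  obtain ⟨ρ, ratio_lt_ρ, hρb⟩ := exists_rat_btwn ratio_lt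
  obtain ⟨hρa, hρ⟩ := max_lt_iff.1 ratio_lt_ρ
  obtain ⟨p, hbp, hpρ⟩ := exists_rat_btwn ((lt_one_sub_div_one_add_comm hρ.le hb.le).1 hρb)
  have hp : (0 : ℝ) < p := hb.trans hbp
  have hp0 : 0 < p := mod_cast hp
  have hρp := (lt_one_sub_div_one_add_comm hp.le hρ.le).1 hpρ
  have hp1 : p ≤ 1 := by
    exact_mod_cast hpρ.le.trans ((div_le_one (by linarith)).2 (by linarith))
  obtain ⟨c, hc⟩ := exists_nat_ge (5 * (3 / ((1 - p : ℝ) / (1 + p) - ρ) + 1) / (p - b))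
  have hc0 : 0 < c := by
    have : (0 : ℝ) < (1 - p) / (1 + p) - ρ := sub_pos.2 hρp
    have : (0 : ℝ) < p - b := sub_pos.2 hbp
    exact_mod_cast (show (0 : ℝ) < _ by positivity).trans_le hc
  refine ⟨ascent c ρ p, ascent_isPolynomialTime c ρ hp0.le hp1, fun n I =>
    Finset.sup'_le _ _ fun S _ => ?_⟩
  calc a * I.g S + b * I.l S ≤ b * ρ * I.g S + b * I.l S := by
        gcongr
        · exact I.g_nonneg S
        · exact ((div_lt_iff₀' hb).1 hρa).le
    _ = b * (ρ * I.g S + I.l S) := by ring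
    _ ≤ (ascent c ρ p).expectedValue I :=
        mul_le_expectedValue_ascent hρ.le hp0 hp1 hρp hb.le hbp hc0 hc I S

theorem self_sub_alpha {β : ℝ} (hβ : 0 ≤ β) : β - alpha β = 2 * β ^ 2 / (1 + β) := by
  rw [alpha]
  field_simp
  ring

theorem alpha_le_self {β : ℝ} (hβ : 0 ≤ β) : alpha β ≤ β := by
  rw [← sub_nonneg, self_sub_alpha hβ]
  positivity

theorem alpha_sub_lt {β ε : ℝ} (hε : 0 < ε) (hεβ : ε ≤ β) : alpha β - ε < alpha (β - ε) := by
  have increasing : (β - ε) - alpha (β - ε) < β - alpha β := by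
    rw [self_sub_alpha (sub_nonneg.2 hεβ), self_sub_alpha (hε.le.trans hεβ),
      div_lt_div_iff₀ (by linarith) (by linarith)]
    nlinarith [mul_nonneg (sub_nonneg.2 hεβ) (hε.le.trans hεβ)]
  linarith

end Approximation

end RUSM

end

theorem theorem2 (β : ℝ) (hβ : 0 < β) (hβ' : β ≤ 1)
    (ε : ℝ) (hε : 0 < ε) (hε' : ε < RUSM.alpha β) :
    ∃ P : RUSM.Program,
      P.IsPolynomialTime ∧ P.IsApproximation (RUSM.alpha β - ε) (β - ε) := by
  have ε_lt_β : ε < β := hε'.trans_le (RUSM.alpha_le_self hβ.le)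
  exact RUSM.exists_isApproximation (sub_pos.2 ε_lt_β) (by linarith)
    (RUSM.alpha_sub_lt hε ε_lt_β.le)
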